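/- Let $f:\mathbb{C}\to\mathbb{C}$ be an entire function and consider the flow $\dot z(t)=f(z(t))$ in real time $t$. A periodic orbit is a nonconstant periodic solution $\gamma$; with its minimal period $T>0$, its index with respect to a point $w$ not on $\gamma$ is $\operatorname{ind}_\gamma(w)=\frac{1}{2\pi i}\int_0^T\frac{\dot\gamma(t)}{\gamma(t)-w}\,dt$. The orbit is said to be around $w$ if $w$ does not lie on $\gamma$ and $\operatorname{ind}_\gamma(w)\neq 0$. A center is a zero $w$ of $f$ that has a punctured neighbourhood all of whose points lie on periodic orbits around $w$. Let $z_0\neq z_1$ be two centers of the flow and, for $i\in\{0,1\}$, let $$P_i=\{z_i\}\cup\{z\in\mathbb{C} : \text{the solution of } \dot z=f(z) \text{ starting at } z \text{ is a periodic orbit around } z_i\}.$$ Let $U\subseteq\mathbb{C}$ be an open set such that $C=\partial P_0\cap\partial P_1\cap U$ is nonempty. Then for every point $z^*\in U$ the following are equivalent: 1. $z^*\in C$; 2. there is $\varepsilon_0>0$ such that for every $0<\varepsilon<\varepsilon_0$ there are points $z_i^*\in P_i$ with $|z_i^*-z^*|<\varepsilon$, $i\in\{0,1\}$, whose orbits $\gamma_i$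 (the solutions with $\gamma_i(0)=z_i^*$) are periodic orbits satisfying $\operatorname{ind}_{\gamma_0}(z_0)\cdot\operatorname{ind}_{\gamma_1}(z_1)=-1$. -/

import Mathlib

open Set Metric Topology

/-- The curve `γ` is a periodic solution of the autonomous equation `ż = f z` with minimal
period `T > 0`. In particular `γ` is not constant. -/
structure IsPeriodicSolution (f : ℂ → ℂ) (γ : ℝ → ℂ) (T : ℝ) : Prop where
  hasDerivAt : ∀ t : ℝ, HasDerivAt γ (f (γ t)) t
  period_pos : 0 < T
  periodic : ∀ t : ℝ, γ (t + T) = γ t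
  minimal : ∀ s : ℝ, 0 < s → s < T → γ s ≠ γ 0

/-- The index (winding number) with respect to `w` of the closed curve `γ`, run through once on
`[0, T]`: the integral `(2πi)⁻¹ ∮ dz / (z - w)`. It is used only for continuously
differentiable closed curves that do not pass through `w`. -/
noncomputable def curveIndex (γ : ℝ → ℂ) (T : ℝ) (w : ℂ) : ℂ :=
  (2 * (Real.pi : ℂ) * Complex.I)⁻¹ * ∫ t in (0 : ℝ)..T, deriv γ t / (γ t - w)

/-- The solution of `ż = f z` starting at `z` is a periodic orbit around `w`: it is a nonconstant
periodic orbit that does not pass through `w` and has nonzero index with respect to `w`. -/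
def IsPeriodicAround (f : ℂ → ℂ) (w z : ℂ) : Prop :=
  ∃ (γ : ℝ → ℂ) (T : ℝ), IsPeriodicSolution f γ T ∧ γ 0 = z ∧ w ∉ range γ ∧
    curveIndex γ T w ≠ 0

/-- A center of `ż = f z`: an equilibrium having a punctured neighbourhood
all of whose points lie on periodic orbits around it. -/
def IsCenter (f : ℂ → ℂ) (w : ℂ) : Prop :=
  f w = 0 ∧ ∀ᶠ z in 𝓝[≠] w, IsPeriodicAround f w z

/-- The region consisting of `w` and the starting points of periodic orbits around `w`. -/
def periodAnnulus (f : ℂ → ℂ) (w : ℂ) : Set ℂ :=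
  {w} ∪ {z | IsPeriodicAround f w z}

namespace HolomorphicFlow

/-! ### Uniqueness and the local holomorphic flow of an entire vector field -/

/-! Write λ for `deriv f w` at a center w. Then λ is nonzero and purely imaginary, and a holomorphic
map Ψ on a disc conjugates the rotation ζ ↦ ζ exp(λt) to the flow near w (`exists_isLinearization`).
The main point is that such discs exhaust the period annulus (`mem_periodAnnulus_iff`): as long as
the images stay inside a bounded set, flowing for a complex time enlarges the disc by a fixed
factor, while Cauchy's estimate bounds its radius.

Consequently the annulus is open, each of its periodic orbits is the image of a circle, and its
index about w is λ/(|λ|i) = ±1, depending only on w (`curveIndex_of_mem_periodAnnulus`). Annuli of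
distinct centers are disjoint, so a point in both closures lies on both frontiers; this gives 2 ⇒ 1.

For 1 ⇒ 2, a common boundary point p is not an equilibrium, since the average of an orbit over one
period is its center (`apply_ne_zero_of_mem_closure`). Hence p has a flow box in complex time.
Moving in a complex time s with Re(λs) ≤ 0 does not increase |ζ|, so it stays inside the annulus:
each annulus fills the side of p in direction λ/|λ| = ±i. Equal signs would make the two annuli
meet, so the indices are opposite. -/

theorem exists_lipschitzOnWith_closedBall {f : ℂ → ℂ} (hf : Differentiable ℂ f)
    (M : ℝ) : ∃ K, LipschitzOnWith K f (closedBall 0 M) :=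
  ((hf.contDiff (n := 1)).contDiffOn.restrict_scalars ℝ).exists_lipschitzOnWith (by simp)
    (convex_closedBall 0 M) (isCompact_closedBall 0 M)

theorem norm_sub_sub_deriv_mul_le {f : ℂ → ℂ} (hf : Differentiable ℂ f)
    (M : ℝ) : ∃ B : ℝ, 0 ≤ B ∧ ∀ x ∈ closedBall (0 : ℂ) M, ∀ y ∈ closedBall (0 : ℂ) M,
      ‖f y - f x - deriv f x * (y - x)‖ ≤ B * ‖y - x‖ ^ 2 := by
  obtain ⟨K, hK⟩ := exists_lipschitzOnWith_closedBall (Differentiable.deriv hf) M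
  refine ⟨K, K.2, fun x hx y hy ↦ ?_⟩
  have hseg : segment ℝ x y ⊆ closedBall 0 M := (convex_closedBall 0 M).segment_subset hx hy
  have key := (convex_segment (𝕜 := ℝ) x y).norm_image_sub_le_of_norm_hasDerivWithin_le
    (f := fun z ↦ f z - deriv f x * z) (f' := fun z ↦ deriv f z - deriv f x)
    (C := K * ‖y - x‖)
    (fun z _ ↦ ((hf z).hasDerivAt.sub (by
      simpa using (hasDerivAt_id z).const_mul (deriv f x))).hasDerivWithinAt)
    (fun z hz ↦ (hK.norm_sub_le (hseg hz) hx).trans (by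
      gcongr
      exact norm_sub_le_of_mem_segment hz))
    (left_mem_segment ℝ x y) (right_mem_segment ℝ x y)
  calc _ = ‖f y - deriv f x * y - (f x - deriv f x * x)‖ := by congr 1; ring
    _ ≤ _ := by rw [pow_two, ← mul_assoc]; exact key

theorem _root_.HasDerivWithinAt.Ici_of_Icc {E : Type*} [NormedAddCommGroup E] [NormedSpace ℝ E]
    {y : ℝ → E} {y' : E} {a b t : ℝ}
    (h : HasDerivWithinAt y y' (Icc a b) t) (ht : t ∈ Ico a b) :
    HasDerivWithinAt y y' (Ici t) t :=
  h.mono_of_mem_nhdsWithin (Icc_mem_nhdsGE_of_mem ht)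

/-- The factor c lets one uniqueness statement cover forward time, reversed time (c = -1) and rays
in complex time. Both curves are bounded on the compact interval, so a local Lipschitz constant
suffices. -/
theorem eqOn_of_hasDerivWithinAt {f : ℂ → ℂ} (hf : Differentiable ℂ f) {c : ℂ}
    {y₁ y₂ : ℝ → ℂ} {a b : ℝ}
    (h₁ : ∀ t ∈ Icc a b, HasDerivWithinAt y₁ (c * f (y₁ t)) (Icc a b) t)
    (h₂ : ∀ t ∈ Icc a b, HasDerivWithinAt y₂ (c * f (y₂ t)) (Icc a b) t)
    (h : y₁ a = y₂ a) : EqOn y₁ y₂ (Icc a b) := by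
  have c₁ : ContinuousOn y₁ (Icc a b) := fun t ht ↦ (h₁ t ht).continuousWithinAt
  have c₂ : ContinuousOn y₂ (Icc a b) := fun t ht ↦ (h₂ t ht).continuousWithinAt
  obtain ⟨M₁, hM₁⟩ := isCompact_Icc.exists_bound_of_continuousOn c₁
  obtain ⟨M₂, hM₂⟩ := isCompact_Icc.exists_bound_of_continuousOn c₂
  obtain ⟨K, hK⟩ := exists_lipschitzOnWith_closedBall (hf.const_mul c) (max M₁ M₂)
  refine ODE_solution_unique_of_mem_Icc_right (v := fun _ z ↦ c * f z)
    (s := fun _ ↦ closedBall 0 (max M₁ M₂)) (fun _ _ ↦ hK) c₁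
    (fun t ht ↦ (h₁ t (Ico_subset_Icc_self ht)).Ici_of_Icc ht)
    (fun t ht ↦ ?_) c₂ (fun t ht ↦ (h₂ t (Ico_subset_Icc_self ht)).Ici_of_Icc ht)
    (fun t ht ↦ ?_) h
  · simpa using Or.inl (hM₁ t (Ico_subset_Icc_self ht))
  · simpa using Or.inr (hM₂ t (Ico_subset_Icc_self ht))

/-- Two solutions of `ż = f z` on the whole real line that agree at `0` are equal. -/
theorem solution_unique {f : ℂ → ℂ} (hf : Differentiable ℂ f)
    {y₁ y₂ : ℝ → ℂ} (h₁ : ∀ t, HasDerivAt y₁ (f (y₁ t)) t)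
    (h₂ : ∀ t, HasDerivAt y₂ (f (y₂ t)) t) (h : y₁ 0 = y₂ 0) : y₁ = y₂ := by
  have hpos : ∀ t, 0 ≤ t → y₁ t = y₂ t := fun t ht ↦
    eqOn_of_hasDerivWithinAt hf (c := 1) (a := 0) (b := t)
      (fun s _ ↦ by simpa using (h₁ s).hasDerivWithinAt)
      (fun s _ ↦ by simpa using (h₂ s).hasDerivWithinAt) h ⟨ht, le_rfl⟩
  have hneg : ∀ t, 0 ≤ t → y₁ (-t) = y₂ (-t) := fun t ht ↦
    eqOn_of_hasDerivWithinAt hf (c := -1) (y₁ := fun s ↦ y₁ (-s)) (y₂ := fun s ↦ y₂ (-s))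
      (a := 0) (b := t)
      (fun s _ ↦ by
        simpa [Function.comp_def] using ((h₁ (-s)).scomp s (hasDerivAt_neg s)).hasDerivWithinAt)
      (fun s _ ↦ by
        simpa [Function.comp_def] using ((h₂ (-s)).scomp s (hasDerivAt_neg s)).hasDerivWithinAt)
      (by simpa using h) ⟨ht, le_rfl⟩
  funext t
  rcases le_total 0 t with ht | ht
  · exact hpos t ht
  · simpa using hneg (-t) (by linarith)

/-- Uniqueness of solutions in complex time on an open set that is star-shaped about `0`. -/
theorem complex_solution_unique {f : ℂ → ℂ} (hf : Differentiable ℂ f)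
    {g₁ g₂ : ℂ → ℂ} {D : Set ℂ} (hD : StarConvex ℝ 0 D)
    (h₁ : ∀ s ∈ D, HasDerivAt g₁ (f (g₁ s)) s)
    (h₂ : ∀ s ∈ D, HasDerivAt g₂ (f (g₂ s)) s) (h : g₁ 0 = g₂ 0) : EqOn g₁ g₂ D := by
  intro s hs
  have hmem : ∀ t ∈ Icc (0 : ℝ) 1, (t : ℂ) * s ∈ D := fun t ht ↦ by
    simpa using hD.smul_mem hs ht.1 ht.2
  have hd : ∀ t : ℝ, HasDerivAt (fun t : ℝ ↦ (t : ℂ) * s) s t := fun t ↦ by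
    simpa using (Complex.ofRealCLM.hasDerivAt (x := t)).mul_const s
  have := eqOn_of_hasDerivWithinAt hf (c := s) (a := 0) (b := 1)
    (y₁ := fun t : ℝ ↦ g₁ (t * s)) (y₂ := fun t : ℝ ↦ g₂ (t * s))
    (fun t ht ↦ by
      simpa [mul_comm, Function.comp_def] using ((h₁ _ (hmem t ht)).comp t (hd t)).hasDerivWithinAt)
    (fun t ht ↦ by
      simpa [mul_comm, Function.comp_def] using ((h₂ _ (hmem t ht)).comp t (hd t)).hasDerivWithinAt)
    (by simpa using h) (show (1 : ℝ) ∈ Icc (0 : ℝ) 1 by simp)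
  simpa using this

/-- Comparison with the variational equation: if `α` is a Lipschitz local flow of `c • f`, its
time-one map is complex differentiable and its derivative solves the variational equation. -/
theorem hasDerivAt_flow {f : ℂ → ℂ} (hf : Differentiable ℂ f) {c : ℂ}
    {α : ℂ → ℝ → ℂ} {M M' L : ℝ} {z : ℂ} (hz : z ∈ ball (0 : ℂ) M)
    (h0 : ∀ x ∈ ball (0 : ℂ) M, α x 0 = x)
    (hα : ∀ x ∈ ball (0 : ℂ) M, ∀ t ∈ Icc (0 : ℝ) 1,
      HasDerivWithinAt (α x) (c * f (α x t)) (Icc 0 1) t)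
    (hb : ∀ x ∈ ball (0 : ℂ) M, ∀ t ∈ Icc (0 : ℝ) 1, ‖α x t‖ ≤ M')
    (hL : ∀ x ∈ ball (0 : ℂ) M, ∀ t ∈ Icc (0 : ℝ) 1, ‖α x t - α z t‖ ≤ L * ‖x - z‖)
    {E : ℝ → ℂ} (hE0 : E 0 = 1)
    (hE : ∀ t ∈ Icc (0 : ℝ) 1,
      HasDerivWithinAt E (c * deriv f (α z t) * E t) (Icc 0 1) t) :
    HasDerivAt (fun x ↦ α x 1) (E 1) z := by
  obtain ⟨B, hB0, hB⟩ := norm_sub_sub_deriv_mul_le hf M'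
  obtain ⟨K, hK⟩ := (isCompact_closedBall (0 : ℂ) M').exists_bound_of_continuousOn
    (Differentiable.deriv hf).continuous.continuousOn
  have hK0 : 0 ≤ max K 1 := le_max_of_le_right zero_le_one
  set K' := ‖c‖ * max K 1 + 1 with hK'
  have hK'pos : 0 < K' := by positivity
  have key : ∀ x ∈ ball (0 : ℂ) M, ‖α x 1 - α z 1 - E 1 * (x - z)‖ ≤
      (‖c‖ * B * L ^ 2 * (1 / K' * (Real.exp K' - 1))) * ‖x - z‖ ^ 2 := by
    intro x hx
    have h1 : ∀ t ∈ Icc (0 : ℝ) 1,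
        HasDerivWithinAt (fun t ↦ α x t - α z t - E t * (x - z))
          (c * f (α x t) - c * f (α z t) - c * deriv f (α z t) * E t * (x - z)) (Icc 0 1) t :=
      fun t ht ↦ ((hα x hx t ht).sub (hα z hz t ht)).sub ((hE t ht).mul_const _)
    have := norm_le_gronwallBound_of_norm_deriv_right_le (δ := 0) (K := K')
      (ε := ‖c‖ * B * L ^ 2 * ‖x - z‖ ^ 2) (a := 0) (b := 1)
      (fun t ht ↦ (h1 t ht).continuousWithinAt)
      (fun t ht ↦ (h1 t (Ico_subset_Icc_self ht)).Ici_of_Icc ht)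
      (by simp [h0 x hx, h0 z hz, hE0]) ?_ 1 (by simp)
    · refine this.trans (le_of_eq ?_)
      rw [gronwallBound_of_K_ne_0 hK'pos.ne']
      simp only [sub_zero, mul_one, zero_mul, zero_add]
      ring
    · intro t ht
      have ht := Ico_subset_Icc_self ht
      -- The error satisfies the variational equation up to a Taylor remainder of order ‖x - z‖²,
      -- and it starts at 0, so Gronwall keeps it quadratic.
      have e : c * f (α x t) - c * f (α z t) - c * deriv f (α z t) * E t * (x - z)
          = c * deriv f (α z t) * (α x t - α z t - E t * (x - z))
            + c * (f (α x t) - f (α z t) - deriv f (α z t) * (α x t - α z t)) := by ring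
      rw [e]
      refine (norm_add_le _ _).trans (add_le_add ?_ ?_)
      · rw [norm_mul, norm_mul]
        gcongr
        have := (hK (α z t) (by simpa using hb z hz t ht)).trans (le_max_left K 1)
        nlinarith [norm_nonneg c]
      · rw [norm_mul, mul_assoc, mul_assoc]
        gcongr
        refine (hB _ (by simpa using hb z hz t ht) _ (by simpa using hb x hx t ht)).trans ?_
        rw [← mul_pow]
        gcongr
        exact hL x hx t ht
  rw [hasDerivAt_iff_isLittleO]
  have hO : (fun x ↦ α x 1 - α z 1 - (x - z) • E 1) =O[𝓝 z] fun x ↦ ‖x - z‖ ^ 2 := by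
    refine Asymptotics.IsBigO.of_bound
      (‖c‖ * B * L ^ 2 * (1 / K' * (Real.exp K' - 1))) ?_
    filter_upwards [isOpen_ball.mem_nhds hz] with x hx
    simpa [mul_comm] using key x hx
  refine hO.trans_isLittleO ?_
  have : Filter.Tendsto (fun x : ℂ ↦ x - z) (𝓝 z) (𝓝 0) := by
    simpa using (continuous_id.sub continuous_const).tendsto (x := z) (f := fun x : ℂ ↦ x - z)
  exact ((Asymptotics.isLittleO_norm_pow_id one_lt_two).comp_tendsto this)

/-- On a bounded set the flow of an entire function exists for all small complex times `c`. It is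
holomorphic, commutes with the vector field, and fixes the equilibria. -/
theorem exists_flow {f : ℂ → ℂ} (hf : Differentiable ℂ f) (M : ℝ) :
    ∃ δ > 0, ∀ c : ℂ, ‖c‖ ≤ δ → ∃ F : ℂ → ℂ, DifferentiableOn ℂ F (ball 0 M) ∧
      (∀ z ∈ ball 0 M, deriv F z * f z = f (F z)) ∧
      ∀ z ∈ ball 0 M, f z = 0 → F z = z ∧ deriv F z = Complex.exp (c * deriv f z) := by
  rcases le_or_gt M 0 with hM | hM
  · exact ⟨1, one_pos, fun c _ ↦ ⟨id, by simp [ball_eq_empty.2 hM, differentiableOn_id]⟩⟩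
  lift M to NNReal using hM.le
  obtain ⟨N, hN⟩ := (isCompact_closedBall (0 : ℂ) (M + 1)).exists_bound_of_continuousOn
    hf.continuous.continuousOn
  have hN0 : 0 ≤ N := (norm_nonneg (f 0)).trans (hN 0 (by simp; positivity))
  -- This makes the speed of c • f at most 1, so in unit time a point of the M-ball stays in the (M
  -- + 1)-ball.
  refine ⟨1 / (N + 1), by positivity, fun c hc ↦ ?_⟩
  obtain ⟨K, hK⟩ := exists_lipschitzOnWith_closedBall (hf.const_mul c) (M + 1)
  have hpl : IsPicardLindelof (fun _ z ↦ c * f z) (⟨0, by simp⟩ : Icc (0 : ℝ) 1) 0 (M + 1) M 1 K :=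
    IsPicardLindelof.of_time_independent
      (fun x hx ↦ by
        rw [norm_mul]
        calc ‖c‖ * ‖f x‖ ≤ 1 / (N + 1) * N := by gcongr; exact hN x (by simpa using hx)
          _ ≤ 1 := by rw [one_div_mul_eq_div, div_le_one (by positivity)]; linarith)
      (by simpa using hK) (by simp)
  obtain ⟨α, hα, L, hL⟩ := hpl.exists_forall_mem_closedBall_eq_hasDerivWithinAt_lipschitzOnWith
  have hcont : ContinuousOn (Function.uncurry α) (closedBall 0 M ×ˢ Icc 0 1) :=
    continuousOn_prod_of_continuousOn_lipschitzOnWith _ L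
      (fun x hx ↦ HasDerivWithinAt.continuousOn (hα x hx).2) hL
  obtain ⟨M', hM'⟩ := ((isCompact_closedBall (0 : ℂ) M).prod
    (isCompact_Icc (a := (0 : ℝ)) (b := 1))).exists_bound_of_continuousOn hcont
  have hsub : ball (0 : ℂ) M ⊆ closedBall 0 M := ball_subset_closedBall
  have hderiv : ∀ z ∈ ball (0 : ℂ) M, ∀ E : ℝ → ℂ, E 0 = 1 → (∀ t ∈ Icc (0 : ℝ) 1,
      HasDerivWithinAt E (c * deriv f (α z t) * E t) (Icc 0 1) t) →
      HasDerivAt (fun x ↦ α x 1) (E 1) z := fun z hz E hE0 hE ↦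
    hasDerivAt_flow hf (M := M) (M' := M') (L := L) hz (fun x hx ↦ (hα x (hsub hx)).1)
      (fun x hx ↦ (hα x (hsub hx)).2) (fun x hx t ht ↦ hM' (x, t) ⟨hsub hx, ht⟩)
      (fun x hx t ht ↦ (hL t ht).norm_sub_le (hsub hx) (hsub hz)) hE0 hE
  have hfix : ∀ z ∈ ball (0 : ℂ) M, f z = 0 → ∀ t ∈ Icc (0 : ℝ) 1, α z t = z := fun z hz h0 ↦
    eqOn_of_hasDerivWithinAt hf (c := c) (hα z (hsub hz)).2
      (y₂ := fun _ ↦ z) (fun t _ ↦ by simpa [h0] using hasDerivWithinAt_const t _ z)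
      (hα z (hsub hz)).1
  have hzero : ∀ z ∈ ball (0 : ℂ) M, f z = 0 →
      HasDerivAt (fun x ↦ α x 1) (Complex.exp (c * deriv f z)) z := fun z hz h0 ↦ by
    have hexp : ∀ t : ℝ, HasDerivAt (fun t : ℝ ↦ Complex.exp (t * (c * deriv f z)))
        (c * deriv f z * Complex.exp (t * (c * deriv f z))) t := fun t ↦ by
      simpa [mul_comm] using
        ((Complex.ofRealCLM.hasDerivAt (x := t)).mul_const (c * deriv f z)).cexp
    have := hderiv z hz (fun t ↦ Complex.exp (t * (c * deriv f z))) (by simp)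
      (fun t ht ↦ by rw [hfix z hz h0 t ht]; exact (hexp t).hasDerivWithinAt)
    simpa using this
  -- The field along an orbit, divided by its initial value, solves the variational equation; this
  -- yields the commutation with f.
  have hnonzero : ∀ z ∈ ball (0 : ℂ) M, f z ≠ 0 →
      HasDerivAt (fun x ↦ α x 1) (f (α z 1) / f z) z := fun z hz h0 ↦
    hderiv z hz (fun t ↦ f (α z t) / f z) (by
        have : α z 0 = z := (hα z (hsub hz)).1
        simp [this, h0])
      (fun t ht ↦ by
        have := (((hf (α z t)).hasDerivAt.comp_hasDerivWithinAt t
          ((hα z (hsub hz)).2 t ht))).div_const (f z)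
        exact this.congr_deriv (by ring))
  refine ⟨fun x ↦ α x 1, fun z hz ↦ ?_, fun z hz ↦ ?_, fun z hz h0 ↦
    ⟨hfix z hz h0 1 (by simp), (hzero z hz h0).deriv⟩⟩
  · by_cases h0 : f z = 0
    · exact (hzero z hz h0).differentiableAt.differentiableWithinAt
    · exact (hnonzero z hz h0).differentiableAt.differentiableWithinAt
  · by_cases h0 : f z = 0
    · simp [h0, hfix z hz h0 1 (by simp)]
    · rw [(hnonzero z hz h0).deriv, div_mul_cancel₀ _ h0]

/-! ### The derivative of the vector field at a center -/

theorem _root_.Function.Periodic.exists_forall_le {v : ℝ → ℝ} {T : ℝ} (hv : Function.Periodic v T)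
    (hT : 0 < T) (hc : Continuous v) : ∃ t₀, ∀ t, v t ≤ v t₀ := by
  obtain ⟨t₀, -, h⟩ := isCompact_Icc.exists_isMaxOn (nonempty_Icc.2 hT.le) hc.continuousOn
  refine ⟨t₀, fun t ↦ ?_⟩
  obtain ⟨s, hs, e⟩ := hv.exists_mem_Ico₀ hT t
  rw [e]
  exact h (Ico_subset_Icc_self hs)

theorem _root_.IsPeriodicSolution.continuous {f : ℂ → ℂ} {γ : ℝ → ℂ} {T : ℝ}
    (h : IsPeriodicSolution f γ T) : Continuous γ :=
  continuous_iff_continuousAt.2 fun t ↦ (h.hasDerivAt t).continuousAt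

/-- A differentiable function of a point moving on a periodic orbit has a critical point where
it is maximal. -/
theorem exists_max_of_periodic {f : ℂ → ℂ} {γ : ℝ → ℂ} {T : ℝ} (h : IsPeriodicSolution f γ T)
    {V : ℂ → ℝ} {v' : ℝ → ℝ} (hV : ∀ t, HasDerivAt (fun t ↦ V (γ t)) (v' t) t) :
    ∃ t₀, V (γ 0) ≤ V (γ t₀) ∧ v' t₀ = 0 := by
  have hp : Function.Periodic (fun t ↦ V (γ t)) T := fun t ↦ by simp only [h.periodic t]
  obtain ⟨t₀, ht₀⟩ := hp.exists_forall_le h.period_pos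
    (continuous_iff_continuousAt.2 fun t ↦ (hV t).continuousAt)
  exact ⟨t₀, ht₀ 0, IsLocalMax.hasDerivAt_eq_zero (Filter.Eventually.of_forall ht₀) (hV t₀)⟩

/-- At the point of a small orbit closest to w the velocity is orthogonal to the radius. A nonzero
real part would give the linear term a radial component that the remainder cannot cancel. -/
theorem re_deriv_eq_zero_of_isCenter {f : ℂ → ℂ} (hf : Differentiable ℂ f) {w : ℂ}
    (h : IsCenter f w) : (deriv f w).re = 0 := by
  by_contra hre
  have hε : 0 < |(deriv f w).re| / 2 := by positivity
  have ho := (hasDerivAt_iff_isLittleO.1 (hf w).hasDerivAt).def hε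
  obtain ⟨δ, hδ, hball⟩ := Metric.eventually_nhds_iff_ball.1 ho
  have hev : ∀ᶠ z in 𝓝[≠] w, z ∈ ball w δ := nhdsWithin_le_nhds (ball_mem_nhds w hδ)
  obtain ⟨z, ⟨γ, T, hγ, rfl, hw, -⟩, hz⟩ := (h.2.and hev).exists
  obtain ⟨t₀, ht₀, hd⟩ := exists_max_of_periodic hγ (V := fun z ↦ -‖z - w‖ ^ 2)
    (fun t ↦ (((hγ.hasDerivAt t).sub_const w).norm_sq).neg)
  have hlt : ‖γ t₀ - w‖ ≤ ‖γ 0 - w‖ := by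
    simpa using abs_le_of_sq_le_sq' (neg_le_neg_iff.1 ht₀) (norm_nonneg _) |>.2
  have hx : 0 < ‖γ t₀ - w‖ := by
    rw [norm_pos_iff, sub_ne_zero]
    exact fun e ↦ hw ⟨t₀, e⟩
  have hmem : γ t₀ ∈ ball w δ := by
    rw [mem_ball, dist_eq_norm] at hz ⊢
    exact hlt.trans_lt hz
  have hb := hball _ hmem
  rw [h.1, sub_zero, smul_eq_mul] at hb
  set x := γ t₀ - w with hxdef
  have hi : inner ℝ x (f (γ t₀)) = 0 := by linarith
  have hlin : inner ℝ x (x * deriv f w) = (deriv f w).re * ‖x‖ ^ 2 := by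
    rw [Complex.inner, ← Complex.normSq_eq_norm_sq, Complex.normSq_apply]
    simp
    ring
  have hdiff : (deriv f w).re * ‖x‖ ^ 2 = - inner ℝ x (f (γ t₀) - x * deriv f w) := by
    rw [inner_sub_right, hi, hlin]; ring
  have hle := abs_real_inner_le_norm x (f (γ t₀) - x * deriv f w)
  have : |(deriv f w).re| * ‖x‖ ^ 2 ≤ ‖x‖ * (|(deriv f w).re| / 2 * ‖x‖) := by
    calc |(deriv f w).re| * ‖x‖ ^ 2 = |(deriv f w).re * ‖x‖ ^ 2| := by
          rw [abs_mul, abs_of_nonneg (sq_nonneg ‖x‖)]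
      _ ≤ _ := by rw [hdiff, abs_neg]; exact hle.trans (by gcongr)
  nlinarith [mul_pos hε (mul_pos hx hx)]

/-- At a zero of order n + 1 ≥ 2, f = (z - w)^(n+1) g, the function Re(κ(z - w)^(-n)) has derivative
Re(g(z)/g(w)) > 1/2 along the flow near w. On a periodic orbit where it takes a large value, its
maximum is attained near w, where the derivative would have to vanish. -/
theorem deriv_ne_zero_of_isCenter {f : ℂ → ℂ} (hf : Differentiable ℂ f) {w : ℂ}
    (h : IsCenter f w) : deriv f w ≠ 0 := by
  intro hd0
  have hne : ∀ᶠ z in 𝓝[≠] w, f z ≠ 0 := by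
    filter_upwards [h.2] with z hz h0
    obtain ⟨γ, T, hγ, rfl, -, -⟩ := hz
    have := solution_unique hf hγ.hasDerivAt (y₂ := fun _ ↦ γ 0)
      (fun t ↦ by rw [h0]; exact hasDerivAt_const t _) rfl
    exact hγ.minimal (T / 2) (half_pos hγ.period_pos) (half_lt_self hγ.period_pos)
      (congrFun this _)
  obtain ⟨m, g, hg, hg0, hfg⟩ := (AnalyticAt.exists_eventuallyEq_pow_smul_nonzero_iff
    (hf.analyticAt w)).2 fun h0 ↦ by
      obtain ⟨z, hz, hz'⟩ := (hne.and (nhdsWithin_le_nhds h0)).exists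
      exact hz hz'
  obtain ⟨n, rfl, hn⟩ : ∃ n, m = n + 1 ∧ n ≠ 0 := by
    rcases m with - | n
    · have := hfg.self_of_nhds
      simp [h.1] at this
      exact absurd this.symm hg0
    · refine ⟨n, rfl, fun hn ↦ ?_⟩
      subst hn
      have := Filter.EventuallyEq.deriv_eq hfg
      have h2 : HasDerivAt (fun z ↦ (z - w) ^ (0 + 1) • g z) (g w) w := by
        have := ((hasDerivAt_id w).sub_const w).mul hg.differentiableAt.hasDerivAt
        simpa [Pi.mul_def] using this
      rw [h2.deriv, hd0] at this
      exact hg0 this.symm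
  set κ : ℂ := -1 / (n * g w) with hκ
  have hnC : (n : ℂ) ≠ 0 := by exact_mod_cast hn
  have hκ0 : κ ≠ 0 := by simp [hκ, hnC, hg0]
  -- On the ray w + sη the function equals s^(-n), which is unbounded as s → 0.
  obtain ⟨η, hη⟩ := IsAlgClosed.exists_pow_nat_eq κ (Nat.pos_of_ne_zero hn)
  have hη0 : η ≠ 0 := fun e ↦ hκ0 (by rw [← hη, e, zero_pow hn])
  have hre : ∀ᶠ z in 𝓝 w, 1 / 2 < (g z / g w).re := by
    have : ContinuousAt (fun z ↦ (g z / g w).re) w :=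
      Complex.continuous_re.continuousAt.comp (hg.continuousAt.div_const _)
    refine this.eventually (lt_mem_nhds ?_)
    simp only [div_self hg0, Complex.one_re]; norm_num
  obtain ⟨δ, hδ, hball⟩ := Metric.eventually_nhds_iff_ball.1 (hre.and hfg)
  -- Twice the largest possible value at distance at least δ from w, so values ≥ K occur only inside
  -- the δ-ball.
  set K : ℝ := ‖κ‖ * 2 / δ ^ n with hK
  have hs : Filter.Tendsto (fun s : ℝ ↦ w + s * η) (𝓝[>] 0) (𝓝[≠] w) := by
    refine tendsto_nhdsWithin_iff.2 ⟨?_, ?_⟩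
    · have : Continuous fun s : ℝ ↦ w + s * η := by fun_prop
      simpa using (this.tendsto 0).mono_left nhdsWithin_le_nhds
    · filter_upwards [self_mem_nhdsWithin] with s hs
      have : s ≠ 0 := (mem_Ioi.1 hs).ne'
      simp [hη0, this]
  have hlarge : ∀ᶠ s : ℝ in 𝓝[>] 0, K ≤ (s ^ n)⁻¹ := by
    have : Filter.Tendsto (fun s : ℝ ↦ (s⁻¹) ^ n) (𝓝[>] 0) Filter.atTop :=
      (Filter.tendsto_pow_atTop hn).comp tendsto_inv_nhdsGT_zero
    simpa [inv_pow] using this.eventually_ge_atTop K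
  obtain ⟨s, ⟨hs1, hs2⟩, hs0⟩ := ((hs.eventually h.2).and hlarge).and self_mem_nhdsWithin |>.exists
  have hs0 : 0 < s := hs0
  obtain ⟨γ, T, hγ, hγ0, hw, -⟩ := hs1
  have hγw : ∀ t, γ t - w ≠ 0 := fun t ↦ sub_ne_zero.2 fun e ↦ hw ⟨t, e⟩
  have hder : ∀ t, HasDerivAt (fun t ↦ (κ * ((γ t - w) ^ n)⁻¹).re)
      ((κ * (-(n * (γ t - w) ^ (n - 1) * f (γ t)) / ((γ t - w) ^ n) ^ 2)).re) t := fun t ↦ by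
    have h1 := ((((hγ.hasDerivAt t).sub_const w).pow n).inv (pow_ne_zero n (hγw t))).const_mul κ
    exact (Complex.reCLM.hasFDerivAt.comp_hasDerivAt t h1)
  obtain ⟨t₀, ht₀, hd⟩ := exists_max_of_periodic hγ (V := fun z ↦ (κ * ((z - w) ^ n)⁻¹).re) hder
  have hKle : K ≤ (κ * ((γ t₀ - w) ^ n)⁻¹).re := by
    refine le_trans ?_ ht₀
    have : κ * ((γ 0 - w) ^ n)⁻¹ = (((s ^ n)⁻¹ : ℝ) : ℂ) := by
      have hsC : (s : ℂ) ≠ 0 := by exact_mod_cast hs0.ne'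
      rw [hγ0, add_sub_cancel_left, mul_pow, hη]
      push_cast
      field_simp
    rw [this, Complex.ofReal_re]
    exact hs2
  have hmem : γ t₀ ∈ ball w δ := by
    rw [mem_ball, dist_eq_norm]
    by_contra! hge
    have h1 : K ≤ ‖κ‖ / ‖γ t₀ - w‖ ^ n := by
      refine (hKle.trans (Complex.re_le_norm _)).trans (le_of_eq ?_)
      simp [div_eq_mul_inv]
    have h2 : ‖κ‖ / ‖γ t₀ - w‖ ^ n ≤ ‖κ‖ / δ ^ n := by gcongr
    have h3 : ‖κ‖ / δ ^ n < K := by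
      rw [hK]
      have : 0 < ‖κ‖ := norm_pos_iff.2 hκ0
      gcongr
      linarith
    linarith
  obtain ⟨hpos, heq⟩ := hball _ hmem
  have : κ * (-(n * (γ t₀ - w) ^ (n - 1) * f (γ t₀)) / ((γ t₀ - w) ^ n) ^ 2)
      = g (γ t₀) / g w := by
    have hx := hγw t₀
    rw [heq, smul_eq_mul, hκ]
    obtain ⟨k, rfl⟩ := Nat.exists_eq_succ_of_ne_zero hn
    simp only [Nat.succ_eq_add_one, Nat.add_sub_cancel]
    field_simp
    ring
  rw [this] at hd
  linarith

/-! ### Local inverses and linearizing coordinates -/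

theorem exists_local_inverse {χ χ' : ℂ → ℂ} {w : ℂ} {ρ : ℝ} (hρ : 0 < ρ)
    (hχ : ∀ z ∈ ball w ρ, HasDerivAt χ (χ' z) z) (hne : ∀ z ∈ ball w ρ, χ' z ≠ 0) :
    ∃ r > 0, ∃ Ψ : ℂ → ℂ, (∀ ζ ∈ ball (χ w) r, Ψ ζ ∈ ball w ρ ∧ χ (Ψ ζ) = ζ ∧
      HasDerivAt Ψ (χ' (Ψ ζ))⁻¹ ζ) ∧ ∀ᶠ z in 𝓝 w, Ψ (χ z) = z := by
  have hw : w ∈ ball w ρ := mem_ball_self hρ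
  have han : AnalyticAt ℂ χ w := DifferentiableOn.analyticAt
    (fun z hz ↦ (hχ z hz).differentiableAt.differentiableWithinAt) (ball_mem_nhds w hρ)
  have hst : HasStrictDerivAt χ (χ' w) w := (hχ w hw).deriv ▸ han.hasStrictDerivAt
  let e := (hst.hasStrictFDerivAt_equiv (hne w hw)).toOpenPartialHomeomorph χ
  have hws : w ∈ e.source :=
    (hst.hasStrictFDerivAt_equiv (hne w hw)).mem_toOpenPartialHomeomorph_source
  have he : ∀ z, e z = χ z := fun z ↦ rfl
  have htgt : χ w ∈ e.target := e.map_source hws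
  have hsymm : e.symm (χ w) = w := e.left_inv hws
  have hev : ∀ᶠ ζ in 𝓝 (χ w), ζ ∈ e.target ∧ e.symm ζ ∈ ball w ρ :=
    (e.open_target.mem_nhds htgt |> Filter.eventually_of_mem <| fun _ h ↦ h).and
      ((e.continuousAt_symm htgt).eventually (by rw [hsymm]; exact ball_mem_nhds w hρ))
  obtain ⟨r, hr, hball⟩ := Metric.eventually_nhds_iff_ball.1 hev
  refine ⟨r, hr, e.symm, fun ζ hζ ↦ ?_, ?_⟩
  · obtain ⟨h1, h2⟩ := hball ζ hζ
    exact ⟨h2, e.right_inv h1, e.hasDerivAt_symm h1 (hne _ h2) (hχ _ h2)⟩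
  · filter_upwards [e.open_source.mem_nhds hws] with z hz using e.left_inv hz

/-- `Ψ` conjugates the linear flow `ζ ↦ exp (f' w * t) * ζ` on the disc of radius `r` to the flow
of `f` near the equilibrium `w`. -/
structure IsLinearization (f : ℂ → ℂ) (w : ℂ) (r : ℝ) (Ψ : ℂ → ℂ) : Prop where
  pos : 0 < r
  differentiableOn : DifferentiableOn ℂ Ψ (ball 0 r)
  map_zero : Ψ 0 = w
  deriv_zero : deriv Ψ 0 = 1
  eq : ∀ ζ ∈ ball (0 : ℂ) r, deriv f w * ζ * deriv Ψ ζ = f (Ψ ζ)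

/-- Linearization of a holomorphic vector field at a simple zero. -/
theorem exists_isLinearization {f : ℂ → ℂ} (hf : Differentiable ℂ f) {w : ℂ} (h0 : f w = 0)
    (hd : deriv f w ≠ 0) : ∃ r Ψ, IsLinearization f w r Ψ := by
  set lam := deriv f w with hlam
  set g := dslope f w with hg
  have hgw : g w = lam := dslope_same f w
  have hgd : Differentiable ℂ g := by
    rw [← differentiableOn_univ] at hf ⊢
    exact (Complex.differentiableOn_dslope Filter.univ_mem).2 hf
  have hfg : ∀ z, f z = (z - w) * g z := fun z ↦ by
    rw [← smul_eq_mul, hg, sub_smul_dslope, h0, sub_zero]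
  obtain ⟨ρ, hρ, hgne⟩ := Metric.eventually_nhds_iff_ball.1
    (hgd.continuous.continuousAt.eventually_ne (hgw.symm ▸ hd : g w ≠ 0))
  have hq : DifferentiableOn ℂ (fun z ↦ lam / g z) (ball w ρ) :=
    (differentiableOn_const _).div hgd.differentiableOn hgne
  -- With P' = (λ/g - 1)/(z - w), the coordinate χ = (z - w)exp(P) satisfies fχ' = λχ; its inverse
  -- is Ψ. The choice P(w) = 0 gives Ψ'(0) = 1.
  obtain ⟨P, hP0, hP⟩ := ((Complex.differentiableOn_dslope (ball_mem_nhds w hρ)).2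
    hq).isExactOn_ball.with_val_at w 0
  have hχ : ∀ z ∈ ball w ρ, HasDerivAt (fun z ↦ (z - w) * Complex.exp (P z))
      (Complex.exp (P z) * (lam / g z)) z := fun z hz ↦ by
    have h1 := ((hasDerivAt_id z).sub_const w).mul (hP z hz).cexp
    refine h1.congr_deriv ?_
    have h2 := sub_smul_dslope (fun z ↦ lam / g z) w z
    simp only [smul_eq_mul, hgw, div_self hd] at h2
    have h3 : lam / g z = 1 + (z - w) * dslope (fun z ↦ lam / g z) w z := by rw [h2]; ring
    rw [h3, id]
    ring
  obtain ⟨r, hr, Ψ, hΨ, hinv⟩ := exists_local_inverse hρ hχ fun z hz ↦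
    mul_ne_zero (Complex.exp_ne_zero _) (div_ne_zero hd (hgne z hz))
  simp only [sub_self, zero_mul] at hΨ
  have hΨ0 : Ψ 0 = w := by simpa using hinv.self_of_nhds
  refine ⟨r, Ψ, hr, fun ζ hζ ↦ (hΨ ζ hζ).2.2.differentiableAt.differentiableWithinAt, hΨ0, ?_,
    fun ζ hζ ↦ ?_⟩
  · rw [(hΨ 0 (mem_ball_self hr)).2.2.deriv, hΨ0, hP0, hgw, div_self hd]
    simp
  · obtain ⟨h1, h2, h3⟩ := hΨ ζ hζ
    have hgn := hgne _ h1
    rw [h3.deriv, hfg]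
    nth_rw 1 [← h2]
    have := Complex.exp_ne_zero (P (Ψ ζ))
    field_simp
    exact mul_comm _ _

/-- A linearization with values in a bounded set extends to a disc that is larger by a factor
depending only on the bound. -/
theorem exists_isLinearization_extension {f : ℂ → ℂ} (hf : Differentiable ℂ f) {w : ℂ}
    (hd : deriv f w ≠ 0) (M : ℝ) : ∃ q > 1, ∀ r Ψ, IsLinearization f w r Ψ →
      MapsTo Ψ (ball 0 r) (ball 0 M) → ∃ Ψ', IsLinearization f w (q * r) Ψ' := by
  obtain ⟨δ, hδ, hF⟩ := exists_flow hf M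
  have hn : 0 < ‖deriv f w‖ := norm_pos_iff.2 hd
  set q := Real.exp (δ * ‖deriv f w‖) with hq
  have hq1 : 1 < q := Real.one_lt_exp_iff.2 (by positivity)
  have hq0 : 0 < q := Real.exp_pos _
  have hqC : (q : ℂ) ≠ 0 := by exact_mod_cast hq0.ne'
  refine ⟨q, hq1, fun r Ψ h hM ↦ ?_⟩
  -- A time of modulus δ for which cλ is real and positive: in the coordinate ζ the flow is dilation
  -- by q.
  set c : ℂ := δ * ‖deriv f w‖ / deriv f w with hc
  obtain ⟨F, hFd, hFf, hF0⟩ := hF c (by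
    rw [hc, norm_div, norm_mul, Complex.norm_real, Complex.norm_real, norm_norm,
      mul_div_cancel_right₀ _ hn.ne', Real.norm_of_nonneg hδ.le])
  have hexp : Complex.exp (c * deriv f w) = q := by
    rw [hc, div_mul_cancel₀ _ hd, hq]; push_cast; rfl
  have hmem : ∀ ζ ∈ ball (0 : ℂ) (q * r), ζ / q ∈ ball (0 : ℂ) r := fun ζ hζ ↦ by
    rw [mem_ball_zero_iff] at hζ ⊢
    rw [norm_div, Complex.norm_real, Real.norm_of_nonneg hq0.le, div_lt_iff₀ hq0]
    linarith
  have hder : ∀ ζ ∈ ball (0 : ℂ) (q * r), HasDerivAt (fun ζ ↦ F (Ψ (ζ / q)))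
      (deriv F (Ψ (ζ / q)) * (deriv Ψ (ζ / q) * (1 / q))) ζ := fun ζ hζ ↦ by
    have h1 := ((h.differentiableOn _ (hmem ζ hζ)).differentiableAt
      (isOpen_ball.mem_nhds (hmem ζ hζ))).hasDerivAt
    have h2 := ((hFd _ (hM (hmem ζ hζ))).differentiableAt
      (isOpen_ball.mem_nhds (hM (hmem ζ hζ)))).hasDerivAt
    exact h2.comp ζ (h1.comp ζ ((hasDerivAt_id ζ).div_const (q : ℂ)))
  have hw : w ∈ ball 0 M := h.map_zero ▸ hM (mem_ball_self h.pos)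
  have hfw : f w = 0 := by simpa [h.map_zero] using (h.eq 0 (mem_ball_self h.pos)).symm
  have hqr : 0 < q * r := mul_pos hq0 h.pos
  refine ⟨fun ζ ↦ F (Ψ (ζ / q)), hqr, fun ζ hζ ↦
    (hder ζ hζ).differentiableAt.differentiableWithinAt, ?_, ?_, fun ζ hζ ↦ ?_⟩
  · simp [h.map_zero, (hF0 w hw hfw).1]
  · rw [(hder 0 (mem_ball_self hqr)).deriv]
    simp [h.map_zero, h.deriv_zero, (hF0 w hw hfw).2, hexp, hqC]
  · rw [(hder ζ hζ).deriv, ← hFf _ (hM (hmem ζ hζ)), ← h.eq _ (hmem ζ hζ)]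
    ring

/-! ### Geometry of a linearization at a zero with imaginary derivative -/

theorem eq_norm_mul_I_or {lam : ℂ} (hre : lam.re = 0) :
    lam = ‖lam‖ * Complex.I ∨ lam = -(‖lam‖ * Complex.I) := by
  have h : lam = lam.im * Complex.I := by
    conv_lhs => rw [← Complex.re_add_im lam, hre]
    simp
  have hn : ‖lam‖ = |lam.im| := by
    conv_lhs => rw [h]
    simp
  rcases abs_choice lam.im with h' | h'
  · left; rw [hn, h', ← h]
  · right; rw [hn, h']; push_cast; rw [neg_mul, neg_neg, ← h]

theorem exp_mul_period {lam : ℂ} (hre : lam.re = 0) (hd : lam ≠ 0) :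
    Complex.exp (lam * ((2 * Real.pi / ‖lam‖ : ℝ) : ℂ)) = 1 := by
  have hn : (‖lam‖ : ℂ) ≠ 0 := by simpa using hd
  rw [Complex.exp_eq_one_iff]
  rcases eq_norm_mul_I_or hre with h | h
  · refine ⟨1, ?_⟩
    nth_rw 1 [h]
    push_cast
    field_simp
  · refine ⟨-1, ?_⟩
    nth_rw 1 [h]
    push_cast
    field_simp

theorem exp_mul_ne_one {lam : ℂ} (hd : lam ≠ 0) {t : ℝ} (h0 : 0 < t)
    (ht : t < 2 * Real.pi / ‖lam‖) : Complex.exp (lam * t) ≠ 1 := by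
  have hn : 0 < ‖lam‖ := norm_pos_iff.2 hd
  intro h
  obtain ⟨n, hn'⟩ := Complex.exp_eq_one_iff.1 h
  have h1 : ‖lam‖ * t = |(n : ℝ)| * (2 * Real.pi) := by
    have := congrArg norm hn'
    simpa [abs_of_pos h0, abs_of_pos Real.pi_pos] using this
  rw [lt_div_iff₀ hn] at ht
  have hn1 : |(n : ℝ)| < 1 := by
    by_contra! h
    nlinarith [Real.pi_pos]
  have : n = 0 := by
    rw [← Int.abs_lt_one_iff]
    exact_mod_cast hn1
  subst this
  have : 0 < ‖lam‖ * t := by positivity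
  rw [h1] at this
  simp at this

theorem mul_exp_mem_ball {lam : ℂ} (hre : lam.re = 0) {r : ℝ} {ζ : ℂ} (hζ : ζ ∈ ball (0 : ℂ) r)
    (t : ℝ) : ζ * Complex.exp (lam * t) ∈ ball (0 : ℂ) r := by
  rw [mem_ball_zero_iff] at hζ ⊢
  simpa [Complex.norm_exp, hre] using hζ

theorem hasDerivAt_mul_exp (lam ζ s : ℂ) :
    HasDerivAt (fun s : ℂ ↦ ζ * Complex.exp (lam * s)) (lam * (ζ * Complex.exp (lam * s))) s := by
  have := (((hasDerivAt_id s).const_mul lam).cexp).const_mul ζ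
  refine this.congr_deriv ?_
  simp only [id]
  ring

theorem hasDerivAt_mul_exp_ofReal (lam ζ : ℂ) (t : ℝ) :
    HasDerivAt (fun t : ℝ ↦ ζ * Complex.exp (lam * t)) (lam * (ζ * Complex.exp (lam * t))) t :=
  (hasDerivAt_mul_exp lam ζ t).comp_ofReal

/-- The mean value property along one turn of the linear flow. -/
theorem integral_comp_mul_exp {lam : ℂ} (hre : lam.re = 0) (hd : lam ≠ 0) {T : ℝ}
    (hT : Complex.exp (lam * T) = 1) {k : ℂ → ℂ} {r : ℝ} (hk : DifferentiableOn ℂ k (ball 0 r))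
    {ζ : ℂ} (hζ : ζ ∈ ball (0 : ℂ) r) :
    ∫ t in (0 : ℝ)..T, k (ζ * Complex.exp (lam * t)) = T * k 0 := by
  have hr : 0 < r := (norm_nonneg ζ).trans_lt (mem_ball_zero_iff.1 hζ)
  -- A primitive of (k(z) - k(0))/z; it returns to its value after a full turn.
  obtain ⟨K, hK⟩ := ((Complex.differentiableOn_dslope (ball_mem_nhds 0 hr)).2 hk).isExactOn_ball
  have hcont : Continuous fun t : ℝ ↦ k (ζ * Complex.exp (lam * t)) :=
    hk.continuousOn.comp_continuous (by fun_prop) (mul_exp_mem_ball hre hζ)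
  have hder : ∀ t : ℝ, HasDerivAt (fun t : ℝ ↦ K (ζ * Complex.exp (lam * t)))
      (lam * (k (ζ * Complex.exp (lam * t)) - k 0)) t := fun t ↦ by
    refine ((hK _ (mul_exp_mem_ball hre hζ t)).comp t
      (hasDerivAt_mul_exp_ofReal lam ζ t)).congr_deriv ?_
    have := sub_smul_dslope k 0 (ζ * Complex.exp (lam * t))
    rw [sub_zero, smul_eq_mul] at this
    rw [← this]
    ring
  have h1 := intervalIntegral.integral_eq_sub_of_hasDerivAt (a := 0) (b := T) (fun t _ ↦ hder t)
    ((continuous_const.mul (hcont.sub continuous_const)).intervalIntegrable _ _)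
  rw [intervalIntegral.integral_const_mul, intervalIntegral.integral_sub
    (hcont.intervalIntegrable _ _) (by simp)] at h1
  simp only [hT, intervalIntegral.integral_const, sub_zero, Complex.ofReal_zero, mul_zero,
    Complex.exp_zero, sub_self, mul_eq_zero, hd, false_or] at h1
  rw [sub_eq_zero.1 h1, Complex.real_smul]

namespace IsLinearization

variable {f Ψ : ℂ → ℂ} {w : ℂ} {r : ℝ}

theorem hasDerivAt (h : IsLinearization f w r Ψ) {ζ : ℂ} (hζ : ζ ∈ ball (0 : ℂ) r) :
    HasDerivAt Ψ (deriv Ψ ζ) ζ :=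
  ((h.differentiableOn ζ hζ).differentiableAt (isOpen_ball.mem_nhds hζ)).hasDerivAt

theorem hasDerivAt_orbit_complex (h : IsLinearization f w r Ψ) {ζ s : ℂ}
    (hs : ζ * Complex.exp (deriv f w * s) ∈ ball (0 : ℂ) r) :
    HasDerivAt (fun s : ℂ ↦ Ψ (ζ * Complex.exp (deriv f w * s)))
      (f (Ψ (ζ * Complex.exp (deriv f w * s)))) s := by
  refine ((h.hasDerivAt hs).comp s (hasDerivAt_mul_exp (deriv f w) ζ s)).congr_deriv ?_
  rw [← h.eq _ hs, mul_comm]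

theorem hasDerivAt_orbit (h : IsLinearization f w r Ψ) (hre : (deriv f w).re = 0) {ζ : ℂ}
    (hζ : ζ ∈ ball (0 : ℂ) r) (t : ℝ) :
    HasDerivAt (fun t : ℝ ↦ Ψ (ζ * Complex.exp (deriv f w * t)))
      (f (Ψ (ζ * Complex.exp (deriv f w * t)))) t :=
  (h.hasDerivAt_orbit_complex (mul_exp_mem_ball hre hζ t)).comp_ofReal

theorem orbit_eq (hf : Differentiable ℂ f) (h : IsLinearization f w r Ψ)
    (hre : (deriv f w).re = 0) {ζ : ℂ} (hζ : ζ ∈ ball (0 : ℂ) r) {γ : ℝ → ℂ}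
    (hγ : ∀ t, HasDerivAt γ (f (γ t)) t) (h0 : γ 0 = Ψ ζ) :
    γ = fun t : ℝ ↦ Ψ (ζ * Complex.exp (deriv f w * t)) :=
  solution_unique hf hγ (h.hasDerivAt_orbit hre hζ) (by simpa using h0)

/-- The first Fourier coefficient of an orbit is ζΨ'(0) = ζ, and points with the same image have the
same orbit. -/
theorem injOn (hf : Differentiable ℂ f) (h : IsLinearization f w r Ψ)
    (hre : (deriv f w).re = 0) (hd : deriv f w ≠ 0) : InjOn Ψ (ball 0 r) := by
  set lam := deriv f w with hlam
  set T := 2 * Real.pi / ‖lam‖ with hT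
  have hT0 : (T : ℂ) ≠ 0 := by
    have : 0 < T := div_pos (by positivity) (norm_pos_iff.2 hd)
    exact_mod_cast this.ne'
  have key : ∀ ζ ∈ ball (0 : ℂ) r, ∫ t in (0 : ℝ)..T,
      (Ψ (ζ * Complex.exp (lam * t)) - w) * Complex.exp (-(lam * t)) = T * ζ := fun ζ hζ ↦ by
    have hk := integral_comp_mul_exp hre hd (exp_mul_period hre hd)
      ((Complex.differentiableOn_dslope (ball_mem_nhds 0 h.pos)).2 h.differentiableOn) hζ
    rw [dslope_same, h.deriv_zero, mul_one] at hk
    rw [← hT] at hk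
    rw [← hk, ← intervalIntegral.integral_mul_const]
    refine intervalIntegral.integral_congr fun t _ ↦ ?_
    have := sub_smul_dslope Ψ 0 (ζ * Complex.exp (lam * t))
    rw [h.map_zero, sub_zero, smul_eq_mul] at this
    rw [← this, Complex.exp_neg]
    field_simp [Complex.exp_ne_zero]
  intro ζ₁ h₁ ζ₂ h₂ he
  have ho := h.orbit_eq hf hre h₂ (h.hasDerivAt_orbit hre h₁) (by simpa using he)
  have e : (T : ℂ) * ζ₁ = T * ζ₂ := by
    rw [← key ζ₁ h₁, ← key ζ₂ h₂]
    refine intervalIntegral.integral_congr fun t _ ↦ ?_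
    rw [congrFun ho t]
  exact mul_left_cancel₀ hT0 e

theorem eq_zero_of_apply_eq_zero (hf : Differentiable ℂ f) (h : IsLinearization f w r Ψ)
    (hre : (deriv f w).re = 0) (hd : deriv f w ≠ 0) {ζ : ℂ} (hζ : ζ ∈ ball (0 : ℂ) r)
    (h0 : f (Ψ ζ) = 0) : ζ = 0 := by
  by_contra hne
  have ho := h.orbit_eq hf hre hζ (γ := fun _ ↦ Ψ ζ)
    (fun t ↦ by rw [h0]; exact hasDerivAt_const t _) rfl
  have hpos : 0 < 2 * Real.pi / ‖deriv f w‖ := div_pos (by positivity) (norm_pos_iff.2 hd)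
  have e := h.injOn hf hre hd hζ (mul_exp_mem_ball hre hζ _)
    (congrFun ho (2 * Real.pi / ‖deriv f w‖ / 2))
  exact exp_mul_ne_one hd (half_pos hpos) (half_lt_self hpos)
    (mul_left_cancel₀ hne (by rw [mul_one]; exact e.symm))

theorem deriv_ne_zero (hf : Differentiable ℂ f) (h : IsLinearization f w r Ψ)
    (hre : (deriv f w).re = 0) (hd : deriv f w ≠ 0) {ζ : ℂ} (hζ : ζ ∈ ball (0 : ℂ) r) :
    deriv Ψ ζ ≠ 0 := by
  intro h0
  have : ζ = 0 := h.eq_zero_of_apply_eq_zero hf hre hd hζ (by rw [← h.eq ζ hζ, h0, mul_zero])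
  rw [this, h.deriv_zero] at h0
  exact one_ne_zero h0

theorem isOpen_image (hf : Differentiable ℂ f) (h : IsLinearization f w r Ψ)
    (hre : (deriv f w).re = 0) (hd : deriv f w ≠ 0) : IsOpen (Ψ '' ball 0 r) := by
  rw [isOpen_iff_mem_nhds]
  rintro _ ⟨ζ, hζ, rfl⟩
  have hst : HasStrictDerivAt Ψ (deriv Ψ ζ) ζ :=
    (h.differentiableOn.analyticAt (isOpen_ball.mem_nhds hζ)).hasStrictDerivAt
  rw [← hst.map_nhds_eq (h.deriv_ne_zero hf hre hd hζ)]
  exact Filter.image_mem_map (isOpen_ball.mem_nhds hζ)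

theorem isPeriodicSolution (hf : Differentiable ℂ f) (h : IsLinearization f w r Ψ)
    (hre : (deriv f w).re = 0) (hd : deriv f w ≠ 0) {ζ : ℂ} (hζ : ζ ∈ ball (0 : ℂ) r)
    (hne : ζ ≠ 0) :
    IsPeriodicSolution f (fun t : ℝ ↦ Ψ (ζ * Complex.exp (deriv f w * t)))
      (2 * Real.pi / ‖deriv f w‖) where
  hasDerivAt := h.hasDerivAt_orbit hre hζ
  period_pos := div_pos (by positivity) (norm_pos_iff.2 hd)
  periodic t := by
    rw [Complex.ofReal_add, mul_add, Complex.exp_add, exp_mul_period hre hd, mul_one]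
  minimal s h0 hs he := by
    have e := h.injOn hf hre hd (mul_exp_mem_ball hre hζ s) (mul_exp_mem_ball hre hζ 0) he
    simp only [Complex.ofReal_zero, mul_zero, Complex.exp_zero] at e
    exact exp_mul_ne_one hd h0 hs (mul_left_cancel₀ hne e)

/-- The integrand is the holomorphic function λzΨ'/(Ψ - v) along a circle; its mean is its value 0
at the origin. -/
theorem curveIndex_eq_zero (h : IsLinearization f w r Ψ)
    (hre : (deriv f w).re = 0) (hd : deriv f w ≠ 0) {ζ : ℂ} (hζ : ζ ∈ ball (0 : ℂ) r)
    {v : ℂ} (hv : v ∉ Ψ '' ball 0 r) :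
    curveIndex (fun t : ℝ ↦ Ψ (ζ * Complex.exp (deriv f w * t))) (2 * Real.pi / ‖deriv f w‖) v
      = 0 := by
  have hk : DifferentiableOn ℂ (fun z ↦ deriv f w * z * deriv Ψ z / (Ψ z - v)) (ball 0 r) :=
    ((differentiableOn_id.const_mul _).mul (h.differentiableOn.deriv isOpen_ball)).div
      (h.differentiableOn.sub_const v) fun z hz ↦ sub_ne_zero.2 fun e ↦ hv ⟨z, hz, e⟩
  have := integral_comp_mul_exp hre hd (exp_mul_period hre hd) hk hζ
  rw [curveIndex, intervalIntegral.integral_congr (g := fun t : ℝ ↦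
    (fun z ↦ deriv f w * z * deriv Ψ z / (Ψ z - v)) (ζ * Complex.exp (deriv f w * t))), this]
  · simp
  · intro t _
    simp only
    rw [(h.hasDerivAt_orbit hre hζ t).deriv, h.eq _ (mul_exp_mem_ball hre hζ t)]

/-- Here the integrand extends holomorphically over the origin with value λ, because injectivity
keeps (Ψ - w)/z free of zeros. -/
theorem curveIndex_self (hf : Differentiable ℂ f) (h : IsLinearization f w r Ψ)
    (hre : (deriv f w).re = 0) (hd : deriv f w ≠ 0) {ζ : ℂ} (hζ : ζ ∈ ball (0 : ℂ) r)
    (hne : ζ ≠ 0) :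
    curveIndex (fun t : ℝ ↦ Ψ (ζ * Complex.exp (deriv f w * t))) (2 * Real.pi / ‖deriv f w‖) w
      = deriv f w / (‖deriv f w‖ * Complex.I) := by
  have hsl : ∀ z, Ψ z - w = z * dslope Ψ 0 z := fun z ↦ by
    simpa [h.map_zero] using (sub_smul_dslope Ψ 0 z).symm
  have hk : DifferentiableOn ℂ (fun z ↦ deriv f w * (deriv Ψ z / dslope Ψ 0 z)) (ball 0 r) := by
    refine ((h.differentiableOn.deriv isOpen_ball).div
      ((Complex.differentiableOn_dslope (ball_mem_nhds 0 h.pos)).2 h.differentiableOn)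
      fun z hz e ↦ ?_).const_mul _
    have hz0 : z = 0 := h.injOn hf hre hd hz (mem_ball_self h.pos) (by
      rw [h.map_zero, ← sub_eq_zero, hsl, e, mul_zero])
    rw [hz0, dslope_same, h.deriv_zero] at e
    exact one_ne_zero e
  have := integral_comp_mul_exp hre hd (exp_mul_period hre hd) hk hζ
  rw [curveIndex, intervalIntegral.integral_congr (g := fun t : ℝ ↦
    (fun z ↦ deriv f w * (deriv Ψ z / dslope Ψ 0 z)) (ζ * Complex.exp (deriv f w * t))), this]
  · have hn : (‖deriv f w‖ : ℂ) ≠ 0 := by simpa using hd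
    have hpi : (Real.pi : ℂ) ≠ 0 := by exact_mod_cast Real.pi_ne_zero
    rw [dslope_same, h.deriv_zero]
    push_cast
    field_simp
  · intro t _
    simp only
    rw [(h.hasDerivAt_orbit hre hζ t).deriv, ← h.eq _ (mul_exp_mem_ball hre hζ t), hsl]
    have := Complex.exp_ne_zero (deriv f w * t)
    field_simp

end IsLinearization

/-! ### The index of a periodic orbit -/

/-- The principal logarithm is defined along u. Applied to 1 - γ/v and (γ - b)/(γ - a), this shows
that the index vanishes far away and is locally constant. -/
theorem integral_div_eq_zero {u u' : ℝ → ℂ} {T : ℝ} (hu : ∀ t, HasDerivAt u (u' t) t)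
    (hc : Continuous u') (hs : ∀ t, ‖u t - 1‖ < 1) (hp : u T = u 0) :
    ∫ t in (0 : ℝ)..T, u' t / u t = 0 := by
  have hs' : ∀ t, u t ∈ Complex.slitPlane := fun t ↦ by
    simpa using Complex.mem_slitPlane_of_norm_lt_one (hs t)
  have hcu : Continuous u := continuous_iff_continuousAt.2 fun t ↦ (hu t).continuousAt
  rw [intervalIntegral.integral_eq_sub_of_hasDerivAt (f := fun t ↦ Complex.log (u t))
    (fun t _ ↦ (hu t).clog_real (hs' t))
    ((hc.div hcu fun t ↦ Complex.slitPlane_ne_zero (hs' t)).intervalIntegrable _ _), hp, sub_self]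

section

variable {f : ℂ → ℂ} {γ : ℝ → ℂ} {T : ℝ}

theorem _root_.IsPeriodicSolution.apply_period (h : IsPeriodicSolution f γ T) : γ T = γ 0 := by
  simpa using h.periodic 0

theorem _root_.IsPeriodicSolution.period_unique {T' : ℝ} (h : IsPeriodicSolution f γ T)
    (h' : IsPeriodicSolution f γ T') : T = T' := by
  rcases lt_trichotomy T T' with hlt | heq | hlt
  · exact absurd h.apply_period (h'.minimal T h.period_pos hlt)
  · exact heq
  · exact absurd h'.apply_period (h.minimal T' h'.period_pos hlt)

theorem _root_.IsPeriodicSolution.exists_norm_lt (h : IsPeriodicSolution f γ T) :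
    ∃ M, 0 < M ∧ ∀ t, ‖γ t‖ < M := by
  have hp : Function.Periodic (fun t ↦ ‖γ t‖) T := fun t ↦ by simp only [h.periodic t]
  obtain ⟨t₀, ht₀⟩ := hp.exists_forall_le h.period_pos h.continuous.norm
  exact ⟨‖γ t₀‖ + 1, by positivity, fun t ↦ (ht₀ t).trans_lt (lt_add_one _)⟩

theorem _root_.IsPeriodicSolution.exists_le_norm_sub (h : IsPeriodicSolution f γ T) {a : ℂ}
    (ha : a ∉ range γ) : ∃ d > 0, ∀ t, d ≤ ‖γ t - a‖ := by
  have hp : Function.Periodic (fun t ↦ -‖γ t - a‖) T := fun t ↦ by simp only [h.periodic t]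
  obtain ⟨t₀, ht₀⟩ := hp.exists_forall_le h.period_pos (h.continuous.sub continuous_const).norm.neg
  exact ⟨‖γ t₀ - a‖, norm_pos_iff.2 (sub_ne_zero.2 fun e ↦ ha ⟨t₀, e⟩),
    fun t ↦ neg_le_neg_iff.1 (ht₀ t)⟩

theorem _root_.IsPeriodicSolution.deriv_eq (h : IsPeriodicSolution f γ T) :
    deriv γ = fun t ↦ f (γ t) :=
  funext fun t ↦ (h.hasDerivAt t).deriv

theorem curveIndex_eq_zero_of_norm_lt (hf : Differentiable ℂ f) (h : IsPeriodicSolution f γ T)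
    {v : ℂ} (hv : ∀ t, ‖γ t‖ < ‖v‖) : curveIndex γ T v = 0 := by
  have hv0 : v ≠ 0 := norm_pos_iff.1 ((norm_nonneg _).trans_lt (hv 0))
  have hc : Continuous fun t ↦ f (γ t) := hf.continuous.comp h.continuous
  have := integral_div_eq_zero (T := T) (u := fun t ↦ 1 - γ t / v) (u' := fun t ↦ -(f (γ t) / v))
    (fun t ↦ ((h.hasDerivAt t).div_const v).const_sub 1) (hc.div_const v).neg
    (fun t ↦ by
      rw [sub_sub_cancel_left, norm_neg, norm_div, div_lt_one (norm_pos_iff.2 hv0)]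
      exact hv t) (by simp only [h.apply_period])
  rw [curveIndex, h.deriv_eq, intervalIntegral.integral_congr, this, mul_zero]
  intro t _
  have h1 : γ t - v ≠ 0 := fun e ↦ (hv t).ne (by rw [sub_eq_zero.1 e])
  have h2 : v - γ t ≠ 0 := fun e ↦ (hv t).ne (by rw [sub_eq_zero.1 e])
  have h3 : 1 - γ t / v = (v - γ t) / v := by field_simp
  simp only
  rw [h3, neg_div, div_div_div_cancel_right₀ hv0, ← div_neg, neg_sub]

theorem eventually_curveIndex_eq (hf : Differentiable ℂ f) (h : IsPeriodicSolution f γ T) {a : ℂ}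
    (ha : a ∉ range γ) : ∀ᶠ b in 𝓝 a, curveIndex γ T b = curveIndex γ T a := by
  obtain ⟨d, hd, hda⟩ := h.exists_le_norm_sub ha
  have hc : Continuous fun t ↦ f (γ t) := hf.continuous.comp h.continuous
  filter_upwards [ball_mem_nhds a hd] with b hb
  rw [mem_ball, dist_eq_norm] at hb
  have hna : ∀ t, γ t - a ≠ 0 := fun t ↦ norm_pos_iff.1 (hd.trans_le (hda t))
  have hnb : ∀ t, γ t - b ≠ 0 := fun t e ↦ by
    rw [← sub_eq_zero.1 e] at hb
    exact (hda t).not_gt hb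
  have hγa : Continuous fun t ↦ γ t - a := h.continuous.sub continuous_const
  have hγb : Continuous fun t ↦ γ t - b := h.continuous.sub continuous_const
  have := integral_div_eq_zero (T := T) (u := fun t ↦ (γ t - b) / (γ t - a))
    (u' := fun t ↦ (f (γ t) * (γ t - a) - (γ t - b) * f (γ t)) / (γ t - a) ^ 2)
    (fun t ↦ ((h.hasDerivAt t).sub_const b).div ((h.hasDerivAt t).sub_const a) (hna t))
    (((hc.mul hγa).sub (hγb.mul hc)).div (hγa.pow 2) fun t ↦ pow_ne_zero 2 (hna t))
    (fun t ↦ by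
      rw [div_sub_one (hna t), norm_div, div_lt_one (norm_pos_iff.2 (hna t)), sub_sub_sub_cancel_left,
        norm_sub_rev]
      exact hb.trans_le (hda t)) (by simp only [h.apply_period])
  have hib : IntervalIntegrable (fun t ↦ f (γ t) / (γ t - b)) MeasureTheory.volume 0 T :=
    (hc.div hγb hnb).intervalIntegrable _ _
  have hia : IntervalIntegrable (fun t ↦ f (γ t) / (γ t - a)) MeasureTheory.volume 0 T :=
    (hc.div hγa hna).intervalIntegrable _ _
  rw [curveIndex, curveIndex, h.deriv_eq]
  congr 1
  rw [← sub_eq_zero, ← intervalIntegral.integral_sub hib hia, ← this]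
  refine intervalIntegral.integral_congr fun t _ ↦ ?_
  have h1 := hna t
  have h2 := hnb t
  field_simp

end

/-! ### The period annulus of a center -/

variable {f : ℂ → ℂ} {w : ℂ}

/-- A periodic orbit around a linearizable equilibrium lies in the image of a linearization. -/
theorem exists_isLinearization_of_isPeriodicAround (hf : Differentiable ℂ f) (h0 : f w = 0)
    (hre : (deriv f w).re = 0) (hd : deriv f w ≠ 0) {v : ℂ} (hv : IsPeriodicAround f w v) :
    ∃ r Ψ, IsLinearization f w r Ψ ∧ v ∈ Ψ '' ball 0 r := by
  by_contra! hcon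
  obtain ⟨γ, T, hγ, rfl, -, hind⟩ := hv
  obtain ⟨M, hM0, hM⟩ := hγ.exists_norm_lt
  have hdisj : ∀ r Ψ, IsLinearization f w r Ψ → ∀ ζ ∈ ball (0 : ℂ) r, Ψ ζ ∉ range γ := by
    rintro r Ψ h ζ hζ ⟨t₀, ht₀⟩
    have ho := h.orbit_eq hf hre hζ (γ := fun t ↦ γ (t + t₀))
      (fun t ↦ (hγ.hasDerivAt (t + t₀)).comp_add_const t t₀) (by simpa using ht₀)
    have := congrFun ho (-t₀)
    simp only [neg_add_cancel] at this
    exact hcon r Ψ h ⟨_, mul_exp_mem_ball hre hζ (-t₀), this.symm⟩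
  -- The image misses γ, so the index of γ is constant on it, equal to its nonzero value at w; but
  -- it vanishes outside the M-ball.
  have hmaps : ∀ r Ψ, IsLinearization f w r Ψ → MapsTo Ψ (ball 0 r) (ball 0 M) := by
    intro r Ψ h ζ hζ
    have hloc : ∀ ξ ∈ ball (0 : ℂ) r, (fun ξ ↦ curveIndex γ T (Ψ ξ)) =ᶠ[𝓝 ξ]
        fun _ ↦ curveIndex γ T (Ψ ξ) := fun ξ hξ ↦
      (h.hasDerivAt hξ).continuousAt.eventually
        (eventually_curveIndex_eq hf hγ (hdisj r Ψ h ξ hξ))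
    have hconst := isOpen_ball.is_const_of_deriv_eq_zero (convex_ball (0 : ℂ) r).isPreconnected
      (f := fun ξ ↦ curveIndex γ T (Ψ ξ))
      (fun ξ hξ ↦ ((differentiableAt_const _).congr_of_eventuallyEq
        (hloc ξ hξ)).differentiableWithinAt)
      (fun ξ hξ ↦ by simpa using (hloc ξ hξ).deriv_eq) hζ (mem_ball_self h.pos)
    simp only [h.map_zero] at hconst
    by_contra hge
    rw [mem_ball_zero_iff, not_lt] at hge
    exact hind (hconst ▸ curveIndex_eq_zero_of_norm_lt hf hγ fun t ↦ (hM t).trans_le hge)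
  -- Cauchy's estimate on the circle of radius r/2, with Ψ'(0) = 1.
  have hbound : ∀ r Ψ, IsLinearization f w r Ψ → r ≤ 2 * M := by
    intro r Ψ h
    have hr := h.pos
    have hsub : closedBall (0 : ℂ) (r / 2) ⊆ ball 0 r :=
      closedBall_subset_ball (half_lt_self hr)
    have := Complex.norm_deriv_le_of_forall_mem_sphere_norm_le (c := 0) (half_pos hr)
      (h.differentiableOn.diffContOnCl_ball hsub)
      (fun z hz ↦ (mem_ball_zero_iff.1 (hmaps r Ψ h (hsub (sphere_subset_closedBall hz)))).le)
    rw [h.deriv_zero, norm_one, le_div_iff₀ (half_pos hr)] at this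
    linarith
  obtain ⟨q, hq, hext⟩ := exists_isLinearization_extension hf hd M
  obtain ⟨r, Ψ, h⟩ := exists_isLinearization hf h0 hd
  have hall : ∀ n : ℕ, ∃ Ψ, IsLinearization f w (q ^ n * r) Ψ := by
    intro n
    induction n with
    | zero => exact ⟨Ψ, by simpa using h⟩
    | succ n ih =>
      obtain ⟨Ψ', h'⟩ := ih
      rw [pow_succ', mul_assoc]
      exact hext _ _ h' (hmaps _ _ h')
  obtain ⟨n, hn⟩ := pow_unbounded_of_one_lt (2 * M / r) hq
  obtain ⟨Ψ', h'⟩ := hall n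
  rw [div_lt_iff₀ h.pos] at hn
  exact (hbound _ _ h').not_gt hn

theorem IsLinearization.isPeriodicAround {Ψ : ℂ → ℂ} {r : ℝ} (hf : Differentiable ℂ f)
    (h : IsLinearization f w r Ψ) (hre : (deriv f w).re = 0) (hd : deriv f w ≠ 0) {ζ : ℂ}
    (hζ : ζ ∈ ball (0 : ℂ) r) (hne : ζ ≠ 0) : IsPeriodicAround f w (Ψ ζ) := by
  refine ⟨_, _, h.isPeriodicSolution hf hre hd hζ hne, by simp, ?_, ?_⟩
  · rintro ⟨t, ht⟩
    have := h.injOn hf hre hd (mul_exp_mem_ball hre hζ t) (mem_ball_self h.pos)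
      (ht.trans h.map_zero.symm)
    exact mul_ne_zero hne (Complex.exp_ne_zero _) this
  · rw [h.curveIndex_self hf hre hd hζ hne]
    exact div_ne_zero hd (mul_ne_zero (by simpa using hd) Complex.I_ne_zero)

theorem mem_periodAnnulus_iff (hf : Differentiable ℂ f) (hw : IsCenter f w) {v : ℂ} :
    v ∈ periodAnnulus f w ↔ ∃ r Ψ, IsLinearization f w r Ψ ∧ v ∈ Ψ '' ball 0 r := by
  have hre := re_deriv_eq_zero_of_isCenter hf hw
  have hd := deriv_ne_zero_of_isCenter hf hw
  constructor
  · rintro (rfl | hv)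
    · obtain ⟨r, Ψ, h⟩ := exists_isLinearization hf hw.1 hd
      exact ⟨r, Ψ, h, 0, mem_ball_self h.pos, h.map_zero⟩
    · exact exists_isLinearization_of_isPeriodicAround hf hw.1 hre hd hv
  · rintro ⟨r, Ψ, h, ζ, hζ, rfl⟩
    by_cases hne : ζ = 0
    · left
      rw [hne, h.map_zero]
      rfl
    · right
      exact h.isPeriodicAround hf hre hd hζ hne

theorem isOpen_periodAnnulus (hf : Differentiable ℂ f) (hw : IsCenter f w) :
    IsOpen (periodAnnulus f w) := by
  rw [isOpen_iff_mem_nhds]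
  intro v hv
  obtain ⟨r, Ψ, h, hv⟩ := (mem_periodAnnulus_iff hf hw).1 hv
  filter_upwards [(h.isOpen_image hf (re_deriv_eq_zero_of_isCenter hf hw)
    (deriv_ne_zero_of_isCenter hf hw)).mem_nhds hv] with z hz
  exact (mem_periodAnnulus_iff hf hw).2 ⟨r, Ψ, h, hz⟩

/-- A shared orbit would have index ±1 about z₁, yet index 0 because it lies in a linearized disc
around z₀, which contains no other equilibrium. -/
theorem disjoint_periodAnnulus (hf : Differentiable ℂ f) {z₀ z₁ : ℂ} (h₀ : IsCenter f z₀)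
    (h₁ : IsCenter f z₁) (hne : z₀ ≠ z₁) :
    Disjoint (periodAnnulus f z₀) (periodAnnulus f z₁) := by
  have hre₀ := re_deriv_eq_zero_of_isCenter hf h₀
  have hd₀ := deriv_ne_zero_of_isCenter hf h₀
  have hre₁ := re_deriv_eq_zero_of_isCenter hf h₁
  have hd₁ := deriv_ne_zero_of_isCenter hf h₁
  rw [Set.disjoint_left]
  intro v hv₀ hv₁
  obtain ⟨r₀, Ψ₀, l₀, ζ₀, hζ₀, rfl⟩ := (mem_periodAnnulus_iff hf h₀).1 hv₀
  obtain ⟨r₁, Ψ₁, l₁, ζ₁, hζ₁, e⟩ := (mem_periodAnnulus_iff hf h₁).1 hv₁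
  have hn₁ : ζ₁ ≠ 0 := by
    rintro rfl
    have : ζ₀ = 0 := l₀.eq_zero_of_apply_eq_zero hf hre₀ hd₀ hζ₀ (by rw [← e, l₁.map_zero, h₁.1])
    rw [this, l₀.map_zero, l₁.map_zero] at e
    exact hne e.symm
  have hn₀ : ζ₀ ≠ 0 := by
    rintro rfl
    exact hn₁ (l₁.eq_zero_of_apply_eq_zero hf hre₁ hd₁ hζ₁ (by rw [e, l₀.map_zero, h₀.1]))
  have p₀ := l₀.isPeriodicSolution hf hre₀ hd₀ hζ₀ hn₀
  have p₁ := l₁.isPeriodicSolution hf hre₁ hd₁ hζ₁ hn₁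
  have ho := l₀.orbit_eq hf hre₀ hζ₀ p₁.hasDerivAt (by simpa using e)
  have hi := l₁.curveIndex_self hf hre₁ hd₁ hζ₁ hn₁
  rw [ho] at p₁ hi
  rw [← p₀.period_unique p₁, l₀.curveIndex_eq_zero hre₀ hd₀ hζ₀] at hi
  · exact div_ne_zero hd₁ (mul_ne_zero (by simpa using hd₁) Complex.I_ne_zero) hi.symm
  · rintro ⟨ξ, hξ, hξ'⟩
    have : ξ = 0 := l₀.eq_zero_of_apply_eq_zero hf hre₀ hd₀ hξ (by rw [hξ', h₁.1])
    rw [this, l₀.map_zero] at hξ'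
    exact hne hξ'

/-- Every periodic orbit in the period annulus of a center has index `±1`, with the sign of the
imaginary part of the derivative of `f` at the center. -/
theorem curveIndex_of_mem_periodAnnulus (hf : Differentiable ℂ f) (hw : IsCenter f w)
    {γ : ℝ → ℂ} {T : ℝ} (hγ : IsPeriodicSolution f γ T) (h0 : γ 0 ∈ periodAnnulus f w) :
    curveIndex γ T w = deriv f w / (‖deriv f w‖ * Complex.I) := by
  have hre := re_deriv_eq_zero_of_isCenter hf hw
  have hd := deriv_ne_zero_of_isCenter hf hw
  obtain ⟨r, Ψ, h, ζ, hζ, e⟩ := (mem_periodAnnulus_iff hf hw).1 h0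
  have ho := h.orbit_eq hf hre hζ hγ.hasDerivAt e.symm
  have hne : ζ ≠ 0 := by
    rintro rfl
    refine hγ.minimal (T / 2) (half_pos hγ.period_pos) (half_lt_self hγ.period_pos) ?_
    simp [ho]
  subst ho
  rw [hγ.period_unique (h.isPeriodicSolution hf hre hd hζ hne),
    h.curveIndex_self hf hre hd hζ hne]

/-! ### Boundary points of period annuli -/

/-- An equilibrium in the closure of a period annulus is its center. -/
theorem apply_ne_zero_of_mem_closure (hf : Differentiable ℂ f) (hw : IsCenter f w) {p : ℂ}
    (hp : p ∈ closure (periodAnnulus f w)) (hne : p ≠ w) : f p ≠ 0 := by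
  intro h0
  have hre := re_deriv_eq_zero_of_isCenter hf hw
  have hd := deriv_ne_zero_of_isCenter hf hw
  obtain ⟨K, hK⟩ := exists_lipschitzOnWith_closedBall hf (‖p‖ + 1)
  have hKb : ∀ z, ‖z - p‖ ≤ 1 → ‖f z‖ ≤ K * ‖z - p‖ := fun z hz ↦ by
    have := hK.norm_sub_le (x := z) (y := p)
      (by rw [mem_closedBall_zero_iff]; linarith [norm_sub_norm_le z p])
      (by rw [mem_closedBall_zero_iff]; linarith)
    rwa [h0, sub_zero] at this
  set T := 2 * Real.pi / ‖deriv f w‖ with hT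
  have hT0 : 0 < T := div_pos (by positivity) (norm_pos_iff.2 hd)
  have hwp : 0 < ‖w - p‖ := norm_pos_iff.2 (sub_ne_zero.2 hne.symm)
  set ε := min 1 (‖w - p‖ / 2) with hε
  have hε0 : 0 < ε := lt_min one_pos (half_pos hwp)
  set η := ε * Real.exp (-((K + 1) * T)) with hη
  have hη0 : 0 < η := by positivity
  obtain ⟨v, hv, hvp⟩ := Metric.mem_closure_iff.1 hp η hη0
  obtain ⟨r, Ψ, h, ζ, hζ, rfl⟩ := (mem_periodAnnulus_iff hf hw).1 hv
  have hB : ∀ t ≤ T, η * Real.exp ((K + 1) * t) ≤ ε := fun t ht ↦ by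
    rw [hη, mul_assoc, ← Real.exp_add]
    refine mul_le_of_le_one_right hε0.le (Real.exp_le_one_iff.2 ?_)
    have : (0 : ℝ) ≤ K + 1 := by positivity
    nlinarith
  have hder : ∀ t : ℝ, HasDerivAt (fun t : ℝ ↦ Ψ (ζ * Complex.exp (deriv f w * t)) - p)
      (f (Ψ (ζ * Complex.exp (deriv f w * t)))) t := fun t ↦
    (h.hasDerivAt_orbit hre hζ t).sub_const p
  have hclose := image_norm_le_of_norm_deriv_right_lt_deriv_boundary (a := 0) (b := T)
    (B := fun t ↦ η * Real.exp ((K + 1) * t))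
    (B' := fun t ↦ η * (Real.exp ((K + 1) * t) * (K + 1)))
    (fun t _ ↦ (hder t).continuousAt.continuousWithinAt) (fun t _ ↦ (hder t).hasDerivWithinAt)
    (by
      rw [dist_comm, dist_eq_norm] at hvp
      simpa using hvp.le)
    (fun t ↦ (((hasDerivAt_id t).const_mul ((K : ℝ) + 1)).exp.const_mul η).congr_deriv
      (by simp))
    (fun t ht he ↦ by
      refine (hKb _ ?_).trans_lt ?_
      · rw [he]
        exact (hB t ht.2.le).trans (min_le_left _ _)
      · rw [he]
        have : 0 < η * Real.exp ((K + 1) * t) := by positivity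
        linarith)
  -- The orbit stays within ε of p for a whole period, but its mean over the period is w, at
  -- distance at least 2ε.
  have hmean := integral_comp_mul_exp hre hd (exp_mul_period hre hd)
    (h.differentiableOn.sub_const p) hζ
  have hle := intervalIntegral.norm_integral_le_of_norm_le_const (a := 0) (b := T) (C := ε)
    (f := fun t : ℝ ↦ Ψ (ζ * Complex.exp (deriv f w * t)) - p) fun t ht ↦ by
      rw [uIoc_of_le hT0.le] at ht
      exact (hclose (Ioc_subset_Icc_self ht)).trans (hB t ht.2)
  rw [← hT] at hmean
  rw [hmean, h.map_zero, norm_mul, Complex.norm_real, Real.norm_of_nonneg hT0.le, sub_zero,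
    abs_of_pos hT0, mul_comm, mul_le_mul_iff_left₀ hT0] at hle
  linarith [min_le_right 1 (‖w - p‖ / 2)]

/-- A holomorphic flow box at a point that is not an equilibrium. -/
theorem exists_flowBox (hf : Differentiable ℂ f) {p : ℂ} (hp : f p ≠ 0) :
    ∃ δ > 0, ∃ g : ℂ → ℂ, (∀ s ∈ ball (0 : ℂ) δ, HasDerivAt g (f (g s)) s) ∧
      ∀ᶠ v in 𝓝 p, ∃ t ∈ ball (0 : ℂ) (δ / 4), g t = v := by
  obtain ⟨ρ, hρ, hne⟩ := Metric.eventually_nhds_iff_ball.1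
    (hf.continuous.continuousAt.eventually_ne hp)
  have hq : DifferentiableOn ℂ (fun z ↦ (f z)⁻¹) (ball p ρ) := hf.differentiableOn.inv hne
  -- A primitive of 1/f is complex time; its inverse g solves g' = f(g).
  obtain ⟨χ, hχ0, hχ⟩ := hq.isExactOn_ball.with_val_at p 0
  obtain ⟨δ, hδ, g, hg, hinv⟩ :=
    exists_local_inverse hρ hχ fun z hz ↦ inv_ne_zero (hne z hz)
  rw [hχ0] at hg
  refine ⟨δ, hδ, g, fun s hs ↦ by simpa using (hg s hs).2.2, ?_⟩
  have hc : ContinuousAt χ p := (hχ p (mem_ball_self hρ)).continuousAt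
  have hev := hc.eventually (ball_mem_nhds (χ p) (show 0 < δ / 4 by positivity))
  filter_upwards [hinv, hev] with v hv hv'
  exact ⟨χ v, by rwa [hχ0] at hv', hv⟩

/-- Near a regular point in its closure, a period annulus contains the points on a fixed side. -/
theorem flowBox_apply_mem_periodAnnulus (hf : Differentiable ℂ f) (hw : IsCenter f w) {p u : ℂ}
    (hp : p ∈ closure (periodAnnulus f w)) (hu : deriv f w = ‖deriv f w‖ * u) (hu2 : u * u = -1)
    {δ : ℝ} (hδ : 0 < δ) {g : ℂ → ℂ} (hg : ∀ s ∈ ball (0 : ℂ) δ, HasDerivAt g (f (g s)) s)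
    (hgp : ∀ᶠ v in 𝓝 p, ∃ t ∈ ball (0 : ℂ) (δ / 4), g t = v) :
    g (u * (δ / 2 : ℝ)) ∈ periodAnnulus f w := by
  obtain ⟨v, ⟨t, ht, rfl⟩, hv⟩ := (mem_closure_iff_frequently.1 hp).and_eventually hgp
    |>.exists |>.imp fun _ h ↦ h.symm
  obtain ⟨r, Ψ, h, ζ, hζ, e⟩ := (mem_periodAnnulus_iff hf hw).1 hv
  have hun : ‖u‖ = 1 := by
    have := congrArg norm hu2
    rw [norm_mul, norm_neg, norm_one] at this
    nlinarith [norm_nonneg u]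
  -- The complex times for which |ζ exp(λs)| ≤ |ζ| and the flow box is still available; both
  -- solutions exist there and agree.
  set D : Set ℂ := {s | (deriv f w * s).re ≤ 0} ∩ {s | t + s ∈ ball (0 : ℂ) δ} with hD
  have hmem : ∀ s ∈ D, ζ * Complex.exp (deriv f w * s) ∈ ball (0 : ℂ) r := fun s hs ↦ by
    rw [mem_ball_zero_iff] at hζ ⊢
    rw [norm_mul, Complex.norm_exp]
    exact (mul_le_of_le_one_right (norm_nonneg ζ) (Real.exp_le_one_iff.2 hs.1)).trans_lt hζ
  rw [mem_ball_zero_iff] at ht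
  have hstar : StarConvex ℝ 0 D := by
    refine Convex.starConvex (Convex.inter ?_ ?_) ⟨by simp, ?_⟩
    · exact convex_halfSpace_le
        (Complex.reLm.comp (LinearMap.mulLeft ℝ (deriv f w))).isLinear 0
    · exact (convex_ball (0 : ℂ) δ).translate_preimage_right t
    · rw [mem_ofPred_eq, add_zero, mem_ball_zero_iff]
      linarith
  have huniq := complex_solution_unique hf hstar (g₁ := fun s ↦ g (t + s))
    (g₂ := fun s ↦ Ψ (ζ * Complex.exp (deriv f w * s)))
    (fun s hs ↦ (hg (t + s) hs.2).comp_const_add t s)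
    (fun s hs ↦ h.hasDerivAt_orbit_complex (hmem s hs)) (by simp [e])
  have hs : u * (δ / 2 : ℝ) - t ∈ D := by
    refine ⟨?_, ?_⟩
    · have h1 : deriv f w * (u * (δ / 2 : ℝ) - t) = ((‖deriv f w‖ : ℝ) : ℂ) *
          (-(δ / 2 : ℝ) - u * t) := by
        nth_rw 1 [hu]
        linear_combination (‖deriv f w‖ : ℂ) * (δ / 2 : ℝ) * hu2
      rw [mem_ofPred_eq, h1, Complex.re_ofReal_mul]
      refine mul_nonpos_of_nonneg_of_nonpos (norm_nonneg _) ?_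
      have h2 : -(u * t).re ≤ ‖t‖ := by
        have := (neg_le_abs _).trans (Complex.abs_re_le_norm (u * t))
        rwa [norm_mul, hun, one_mul] at this
      rw [Complex.sub_re, Complex.neg_re, Complex.ofReal_re]
      linarith
    · rw [mem_ofPred_eq, add_sub_cancel, mem_ball_zero_iff, norm_mul, hun, one_mul,
        Complex.norm_real, Real.norm_of_nonneg (by positivity)]
      linarith
  have := huniq hs
  simp only [add_sub_cancel] at this
  rw [this]
  exact (mem_periodAnnulus_iff hf hw).2 ⟨r, Ψ, h, _, hmem _ hs, rfl⟩

/-- At a common boundary point of two period annuli, the orbits are oppositely oriented. -/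
theorem index_mul_index_eq_neg_one (hf : Differentiable ℂ f) {z₀ z₁ : ℂ} (h₀ : IsCenter f z₀)
    (h₁ : IsCenter f z₁) (hne : z₀ ≠ z₁) {p : ℂ} (hp₀ : p ∈ closure (periodAnnulus f z₀))
    (hp₁ : p ∈ closure (periodAnnulus f z₁)) (hp : p ≠ z₀) :
    deriv f z₀ / (‖deriv f z₀‖ * Complex.I) * (deriv f z₁ / (‖deriv f z₁‖ * Complex.I)) = -1 := by
  have hn₀ : (‖deriv f z₀‖ : ℂ) ≠ 0 := by simpa using deriv_ne_zero_of_isCenter hf h₀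
  have hn₁ : (‖deriv f z₁‖ : ℂ) ≠ 0 := by simpa using deriv_ne_zero_of_isCenter hf h₁
  obtain ⟨δ, hδ, g, hg, hgp⟩ := exists_flowBox hf (apply_ne_zero_of_mem_closure hf h₀ hp₀ hp)
  -- With the same direction u, the single point g(uδ/2) would belong to both annuli.
  have hsame : ∀ u : ℂ, u * u = -1 → deriv f z₀ = ‖deriv f z₀‖ * u →
      deriv f z₁ ≠ ‖deriv f z₁‖ * u := fun u hu e₀ e₁ ↦
    (disjoint_periodAnnulus hf h₀ h₁ hne).le_bot
      ⟨flowBox_apply_mem_periodAnnulus hf h₀ hp₀ e₀ hu hδ hg hgp,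
        flowBox_apply_mem_periodAnnulus hf h₁ hp₁ e₁ hu hδ hg hgp⟩
  have hI := Complex.I_mul_I
  have hI' : -Complex.I * -Complex.I = -1 := by rw [neg_mul_neg, hI]
  rcases eq_norm_mul_I_or (re_deriv_eq_zero_of_isCenter hf h₀) with e₀ | e₀ <;>
    rcases eq_norm_mul_I_or (re_deriv_eq_zero_of_isCenter hf h₁) with e₁ | e₁
  · exact absurd e₁ (hsame _ hI e₀)
  · nth_rw 1 [e₀]
    nth_rw 1 [e₁]
    rw [neg_div, div_self (mul_ne_zero hn₀ Complex.I_ne_zero),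
      div_self (mul_ne_zero hn₁ Complex.I_ne_zero), one_mul]
  · nth_rw 1 [e₀]
    nth_rw 1 [e₁]
    rw [neg_div, div_self (mul_ne_zero hn₀ Complex.I_ne_zero),
      div_self (mul_ne_zero hn₁ Complex.I_ne_zero), mul_one]
  · rw [← mul_neg] at e₀ e₁
    exact absurd e₁ (hsame _ hI' e₀)

/-- If `p` lies in the closure of two disjoint open sets then it is on the frontier of the first. -/
theorem mem_frontier_of_mem_closure {X : Type*} [TopologicalSpace X] {A B : Set X} {p : X}
    (hA : IsOpen A) (hAB : Disjoint A B) (hpA : p ∈ closure A) (hpB : p ∈ closure B) :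
    p ∈ frontier A := by
  rw [hA.frontier_eq]
  refine ⟨hpA, fun h ↦ ?_⟩
  obtain ⟨x, hx, hx'⟩ := mem_closure_iff.1 hpB A hA h
  exact hAB.le_bot ⟨hx, hx'⟩

end HolomorphicFlow

open HolomorphicFlow in
theorem mainTheorem1 (f : ℂ → ℂ) (hf : Differentiable ℂ f) (z₀ z₁ : ℂ) (hne : z₀ ≠ z₁)
    (h₀ : IsCenter f z₀) (h₁ : IsCenter f z₁) (U : Set ℂ) (hU : IsOpen U)
    (C : Set ℂ) (hC : C = frontier (periodAnnulus f z₀) ∩ frontier (periodAnnulus f z₁) ∩ U)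
    (hCne : C.Nonempty) (zs : ℂ) (hzs : zs ∈ U) :
    zs ∈ C ↔
      ∃ ε₀ : ℝ, 0 < ε₀ ∧ ∀ ε : ℝ, 0 < ε → ε < ε₀ →
        ∃ w₀ ∈ ball zs ε ∩ periodAnnulus f z₀, ∃ w₁ ∈ ball zs ε ∩ periodAnnulus f z₁,
          ∃ (γ₀ γ₁ : ℝ → ℂ) (T₀ T₁ : ℝ),
            IsPeriodicSolution f γ₀ T₀ ∧ γ₀ 0 = w₀ ∧
            IsPeriodicSolution f γ₁ T₁ ∧ γ₁ 0 = w₁ ∧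
            curveIndex γ₀ T₀ z₀ * curveIndex γ₁ T₁ z₁ = -1 := by
  have ho₀ := isOpen_periodAnnulus hf h₀
  have ho₁ := isOpen_periodAnnulus hf h₁
  have hdisj := disjoint_periodAnnulus hf h₀ h₁ hne
  subst hC
  constructor
  · rintro ⟨⟨hf₀, hf₁⟩, -⟩
    rw [ho₀.frontier_eq] at hf₀
    rw [ho₁.frontier_eq] at hf₁
    have hn₀ : zs ≠ z₀ := fun e ↦ hf₀.2 (Or.inl e)
    have hn₁ : zs ≠ z₁ := fun e ↦ hf₁.2 (Or.inl e)
    -- This bound keeps the centers out of the ε-ball, so the nearby annulus points lie on genuine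
    -- periodic orbits.
    refine ⟨min (dist z₀ zs) (dist z₁ zs), lt_min (dist_pos.2 hn₀.symm) (dist_pos.2 hn₁.symm),
      fun ε hε hlt ↦ ?_⟩
    have key : ∀ z, zs ∈ closure (periodAnnulus f z) → ε < dist z zs →
        ∃ v ∈ ball zs ε ∩ periodAnnulus f z, ∃ γ T, IsPeriodicSolution f γ T ∧ γ 0 = v := by
      intro z hz hzε
      obtain ⟨v, hv, hvd⟩ := Metric.mem_closure_iff.1 hz ε hε
      rw [dist_comm] at hvd
      refine ⟨v, ⟨hvd, hv⟩, ?_⟩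
      rcases hv with rfl | ⟨γ, T, hγ, h0, -⟩
      · exact absurd hvd hzε.not_gt
      · exact ⟨γ, T, hγ, h0⟩
    obtain ⟨w₀, hw₀, γ₀, T₀, hγ₀, rfl⟩ := key z₀ hf₀.1 (hlt.trans_le (min_le_left _ _))
    obtain ⟨w₁, hw₁, γ₁, T₁, hγ₁, rfl⟩ := key z₁ hf₁.1 (hlt.trans_le (min_le_right _ _))
    refine ⟨_, hw₀, _, hw₁, γ₀, γ₁, T₀, T₁, hγ₀, rfl, hγ₁, rfl, ?_⟩
    rw [curveIndex_of_mem_periodAnnulus hf h₀ hγ₀ hw₀.2,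
      curveIndex_of_mem_periodAnnulus hf h₁ hγ₁ hw₁.2]
    exact index_mul_index_eq_neg_one hf h₀ h₁ hne hf₀.1 hf₁.1 hn₀
  · rintro ⟨ε₀, hε₀, h⟩
    have hsmall : ∀ ε > 0, ∃ δ, 0 < δ ∧ δ < ε₀ ∧ δ ≤ ε := fun ε hε ↦
      ⟨min ε (ε₀ / 2), lt_min hε (half_pos hε₀), (min_le_right _ _).trans_lt (half_lt_self hε₀),
        min_le_left _ _⟩
    have hc₀ : zs ∈ closure (periodAnnulus f z₀) := Metric.mem_closure_iff.2 fun ε hε ↦ by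
      obtain ⟨δ, hδ, hδ₀, hδε⟩ := hsmall ε hε
      obtain ⟨v, hv, -⟩ := h δ hδ hδ₀
      exact ⟨v, hv.2, (mem_ball'.1 hv.1).trans_le hδε⟩
    have hc₁ : zs ∈ closure (periodAnnulus f z₁) := Metric.mem_closure_iff.2 fun ε hε ↦ by
      obtain ⟨δ, hδ, hδ₀, hδε⟩ := hsmall ε hε
      obtain ⟨_, -, v, hv, -⟩ := h δ hδ hδ₀
      exact ⟨v, hv.2, (mem_ball'.1 hv.1).trans_le hδε⟩
    exact ⟨⟨mem_frontier_of_mem_closure ho₀ hdisj hc₀ hc₁,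
      mem_frontier_of_mem_closure ho₁ hdisj.symm hc₁ hc₀⟩, hzs⟩
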